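/- Let $G$ be a semisimple, simply connected algebraic group (for example, a simple and simply connected one) with maximal torus $T$, and let $p$ be a prime. Let $\Phi$ be its (reduced) root system, $\mathbb{X}$ the character lattice of $T$ (so $\mathbb{X}$ is the full weight lattice), $W$ the Weyl group, and fix simple roots $\alpha_1,\dots,\alpha_n$ with corresponding positive roots $\Phi^+$. Write $\mathbb{X}^+$ for the set of dominant weights, $\rho$ for the half-sum of the positive roots (equivalently, the sum of the fundamental weights), $e(\mu)$ for the basis elements of the group ring $\mathbb{Z}[\mathbb{X}]$, and $s(\mu)=\sum_{\nu\in W\mu}e(\nu)$ for orbit sums. For $\lambda\in\mathbb{X}$ let $\chi(\lambda)\in\mathbb{Z}[\mathbb{X}]^W$ be the element given by Weyl's character formula $$\chi(\lambda)\prod_{\alpha\in\Phi^+}\bigl(1-e(-\alpha)\bigr)=\sum_{w\in W}(-1)^{\ell(w)}\,e\bigl(w(\lambda+\rho)-\rho\bigr);$$ the Weyl characters $\chi(\lambda)$ with $\lambda\in\mathbb{X}^+$ form a $\mathbb{Z}$-basis of $\mathbb{Z}[\mathbb{X}]^W$, called the Weyl basis. Write $\mu\le\mu'$ if $\mu'-\mu$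 is a sum of simple roots with nonnegative integer coefficients. For $\alpha\in\Phi^+$ and $n\in\mathbb{Z}$ let $s_{\alpha,np}(\lambda)=\lambda-(\langle\lambda,\alpha^\vee\rangle-np)\alpha$ and $s_{\alpha,np}\bullet\lambda=s_{\alpha,np}(\lambda+\rho)-\rho$. Write $\lambda\uparrow\mu$ if there is a chain $\lambda\le s_1\bullet\lambda\le s_2\bullet s_1\bullet\lambda\le\cdots\le s_m\bullet\cdots\bullet s_1\bullet\lambda=\mu$ with $m\ge 0$ and every $s_j$ one of the affine reflections $s_{\alpha,np}$. Let $\eta\in\mathbb{Z}[\mathbb{X}]^W$, and write $\eta=\sum_{\mu\in\mathbb{X}^+}c_\mu s(\mu)$ with integers $c_\mu$, all but finitely many of them zero. 1. Suppose that for every $\lambda\in\mathbb{X}^+$ the product $\chi(\lambda)\eta$ has nonnegative coefficients in the Weyl basis. Then $c_\mu\ge c_{\mu'}$ for all $\mu,\mu'\in\mathbb{X}^+$ with $\mu\le\mu'$. 2. Suppose that for every $\lambda\in\mathbb{X}^+$ the product $\chi((p-1)\rho+p\lambda)\eta$ has nonnegative coefficients in the Weyl basis. Then $c_\mu\ge c_{\mu'}$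 for all $\mu,\mu'\in\mathbb{X}^+$ with $\mu-\rho\uparrow\mu'-\rho$. -/

import Mathlib

noncomputable section
namespace WeylChar

section GroupAlgebra
variable {A : Type*} [AddCommGroup A]

/-- The basis element `e(μ)` of the group ring. -/
def e (μ : A) : AddMonoidAlgebra ℤ A := AddMonoidAlgebra.single μ 1

theorem e_mul_e (x y : A) : e x * e y = e (x + y) := by
  simp [e]

theorem one_sub_e_regular {β : A} (hβ : ∀ n : ℕ, 0 < n → n • β ≠ 0) {g : AddMonoidAlgebra ℤ A}
    (h : (1 - e β) * g = 0) : g = 0 := by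
  have h1 : e β * g = g := by linear_combination -h
  have h2 : ∀ x, g.coeff (β + x) = g.coeff x := by
    intro x
    conv_lhs => rw [← h1]
    simp [e]
  have h3 : ∀ (x : A) (n : ℕ), g.coeff (n • β + x) = g.coeff x := by
    intro x n
    induction n with
    | zero => simp
    | succ n ih => rw [← ih, ← h2 (n • β + x)]; congr 1; module
  by_contra hg
  obtain ⟨x, hx⟩ : ∃ x, g.coeff x ≠ 0 := by
    by_contra! hc
    exact hg (by ext x; simpa using hc x)
  have hinj : Function.Injective (fun n : ℕ => n • β + x) := by
    have key : ∀ m n : ℕ, m < n → m • β + x ≠ n • β + x := by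
      intro m n hmn he
      apply hβ (n - m) (by omega)
      have h4 : m • β = n • β := add_right_cancel he
      rw [sub_nsmul _ hmn.le, h4]; simp
    intro m n he
    rcases lt_trichotomy m n with h | h | h
    · exact absurd he (key m n h)
    · exact h
    · exact absurd he.symm (key n m h)
  exact Set.infinite_of_injective_forall_mem (s := (g.coeff.support : Set A)) hinj
    (fun n => by simpa [h3 x n] using hx) (Finset.finite_toSet _)

theorem one_sub_e_dvd_e_sub_e (β x : A) (k : ℤ) : (1 - e β) ∣ e x - e (x + k • β) := by
  induction k with
  | zero => simp
  | succ k ih =>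
    have h : e x - e (x + ((k : ℤ) + 1) • β) = (e x - e (x + (k : ℤ) • β)) +
        (1 - e β) * e (x + (k : ℤ) • β) := by
      rw [sub_mul, e_mul_e, one_mul, show x + ((k : ℤ) + 1) • β = β + (x + (k : ℤ) • β) by module]
      ring
    rw [h]
    exact dvd_add ih (dvd_mul_right _ _)
  | pred k ih =>
    have h : e x - e (x + (-(k : ℤ) - 1) • β) = (e x - e (x + (-(k : ℤ)) • β)) -
        (1 - e β) * e (x + (-(k : ℤ) - 1) • β) := by
      rw [sub_mul, e_mul_e, one_mul,
        show β + (x + (-(k : ℤ) - 1) • β) = x + (-(k : ℤ)) • β by module]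
      ring
    rw [h]
    exact dvd_sub ih (dvd_mul_right _ _)

/-- Reduction of the group ring modulo the subgroup generated by `β`. -/
def modRoot (β : A) :
    AddMonoidAlgebra ℤ A →+* AddMonoidAlgebra ℤ (A ⧸ AddSubgroup.zmultiples β) :=
  AddMonoidAlgebra.mapDomainRingHom ℤ (QuotientAddGroup.mk' (AddSubgroup.zmultiples β))

theorem modRoot_e (β x : A) :
    modRoot β (e x) = e (QuotientAddGroup.mk' (AddSubgroup.zmultiples β) x) := by
  simp [modRoot, e]

theorem one_sub_e_dvd_iff (β : A) (f : AddMonoidAlgebra ℤ A) :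
    (1 - e β) ∣ f ↔ modRoot β f = 0 := by
  constructor
  · rintro ⟨g, rfl⟩
    have : modRoot β (e β) = 1 := by
      rw [modRoot_e, QuotientAddGroup.mk'_apply,
        (QuotientAddGroup.eq_zero_iff β).2 (AddSubgroup.mem_zmultiples β)]
      rfl
    simp [this]
  · intro h
    have key : ∀ f : AddMonoidAlgebra ℤ A, (1 - e β) ∣ f -
        AddMonoidAlgebra.mapDomain Quotient.out (modRoot β f) := by
      intro f
      induction f using AddMonoidAlgebra.induction_linear with
      | zero => simp
      | add x y hx hy =>
        rw [map_add, AddMonoidAlgebra.mapDomain_add]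
        convert dvd_add hx hy using 1
        ring
      | single m r =>
        obtain ⟨k, hk⟩ : ∃ k : ℤ, (Quotient.out (QuotientAddGroup.mk' (AddSubgroup.zmultiples β) m))
            = m + k • β := by
          have h1 := QuotientAddGroup.mk_out_eq_add (AddSubgroup.zmultiples β) m
          obtain ⟨⟨z, k, rfl⟩, hz⟩ := h1
          exact ⟨k, hz⟩
        have : AddMonoidAlgebra.single m r - AddMonoidAlgebra.mapDomain Quotient.out
            (modRoot β (AddMonoidAlgebra.single m r)) = r • (e m - e (m + k • β)) := by
          rw [← hk]
          simp [modRoot, e, smul_sub]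
        rw [this]
        rw [zsmul_eq_mul]
        exact (one_sub_e_dvd_e_sub_e β m k).mul_left _
    simpa [h] using key f

theorem one_sub_e_dvd_of_dvd_mul {α β : A} (h : ∀ n : ℕ, 0 < n → ∀ k : ℤ, k • α ≠ n • β)
    {g : AddMonoidAlgebra ℤ A} (hg : (1 - e α) ∣ (1 - e β) * g) : (1 - e α) ∣ g := by
  rw [one_sub_e_dvd_iff] at hg ⊢
  rw [map_mul, map_sub, map_one, modRoot_e] at hg
  refine one_sub_e_regular (fun n hn h0 => ?_) hg
  rw [← map_nsmul, QuotientAddGroup.mk'_apply, QuotientAddGroup.eq_zero_iff] at h0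
  obtain ⟨k, hk⟩ := h0
  exact h n hn k hk

theorem prod_one_sub_e_dvd {κ : Type*} (α : κ → A) (s : Finset κ)
    (h : ∀ i ∈ s, ∀ j ∈ s, i ≠ j → ∀ n : ℕ, 0 < n → ∀ k : ℤ, k • α i ≠ n • α j)
    {f : AddMonoidAlgebra ℤ A} (hf : ∀ i ∈ s, (1 - e (α i)) ∣ f) :
    ∏ i ∈ s, (1 - e (α i)) ∣ f := by
  classical
  induction s using Finset.induction_on with
  | empty => simp
  | insert i s hi ih =>
    obtain ⟨g, rfl⟩ := ih
      (fun a ha c hc => h a (Finset.mem_insert_of_mem ha) c (Finset.mem_insert_of_mem hc))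
      (fun a ha => hf a (Finset.mem_insert_of_mem ha))
    have key : ∀ t ⊆ s, (1 - e (α i)) ∣ (∏ j ∈ t, (1 - e (α j))) * g → (1 - e (α i)) ∣ g := by
      intro t
      induction t using Finset.induction_on with
      | empty => simp
      | insert j t hj iht =>
        intro hts hd
        rw [Finset.prod_insert hj, mul_assoc] at hd
        have hjs : j ∈ s := hts (Finset.mem_insert_self _ _)
        refine iht (fun a ha => hts (Finset.mem_insert_of_mem ha))
          (one_sub_e_dvd_of_dvd_mul (h i (Finset.mem_insert_self _ _) j
            (Finset.mem_insert_of_mem hjs) ?_) hd)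
        rintro rfl
        exact hi hjs
    obtain ⟨q, rfl⟩ := key s subset_rfl (hf i (Finset.mem_insert_self _ _))
    rw [Finset.prod_insert hi]
    exact ⟨q, by ring⟩

end GroupAlgebra

variable {ι X Y : Type*} [AddCommGroup X] [AddCommGroup Y]

/-- The root datum of a semisimple, simply connected group: the coroots generate the cocharacter
lattice (equivalently, the simple coroots are a `ℤ`-basis of it, so that the character lattice `X`
has the basis of fundamental weights). -/
class IsSimplyConnected (P : RootDatum ι X Y) : Prop where
  span_coroot_eq_top : Submodule.span ℤ (Set.range P.coroot) = ⊤

/-- A weight is determined by its pairings with the simple coroots. -/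
theorem eq_of_coroot_eq (P : RootDatum ι X Y) [IsSimplyConnected P] (b : P.Base) {x y : X}
    (h : ∀ i ∈ b.support, P.toLinearMap x (P.coroot i) = P.toLinearMap y (P.coroot i)) :
    x = y := by
  have h1 : P.toLinearMap x = P.toLinearMap y := by
    have hs : Submodule.span ℤ (P.coroot '' b.support) = ⊤ := by
      rw [b.span_int_coroot_support, IsSimplyConnected.span_coroot_eq_top]
    apply LinearMap.ext_on hs
    rintro _ ⟨i, hi, rfl⟩
    exact h i hi
  exact P.toLinearMap.toPerfPair.injective (LinearMap.ext fun z => by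
    simpa using LinearMap.congr_fun h1 z)

theorem existsUnique_weylVector {P : RootDatum ι X Y} [IsSimplyConnected P] (b : P.Base) :
    ∃! ρ : X, ∀ i ∈ b.support, P.toLinearMap ρ (P.coroot i) = 1 := by
  have hs : ⊤ ≤ Submodule.span ℤ (Set.range fun i : b.support => P.coroot i) := by
    have h : Set.range (fun i : b.support => P.coroot i) = P.coroot '' b.support := by
      ext; simp
    rw [h, b.span_int_coroot_support, IsSimplyConnected.span_coroot_eq_top]
  let B : Module.Basis b.support ℤ Y := Module.Basis.mk b.linearIndepOn_coroot hs
  let f : Y →ₗ[ℤ] ℤ := B.constr ℤ (fun _ => (1 : ℤ))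
  refine ⟨P.toLinearMap.toPerfPair.symm f, ?_, ?_⟩
  · intro i hi
    have h1 : f (B ⟨i, hi⟩) = 1 := B.constr_basis ℤ _ _
    rw [← h1, ← LinearMap.toPerfPair_apply, LinearEquiv.apply_symm_apply]
    simp [B]
  · intro y hy
    apply eq_of_coroot_eq P b
    intro i hi
    have h1 : f (B ⟨i, hi⟩) = 1 := B.constr_basis ℤ _ _
    rw [hy i hi, ← h1, ← LinearMap.toPerfPair_apply, LinearEquiv.apply_symm_apply]
    simp [B]

/-- The weight `ρ`: the sum of the fundamental weights, that is, the unique weight whose pairing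
with every simple coroot is `1`. -/
def weylVector {P : RootDatum ι X Y} [IsSimplyConnected P] (b : P.Base) : X :=
  (existsUnique_weylVector b).choose

theorem weylVector_coroot {P : RootDatum ι X Y} [IsSimplyConnected P] (b : P.Base) {i : ι}
    (hi : i ∈ b.support) : P.toLinearMap (weylVector b) (P.coroot i) = 1 :=
  (existsUnique_weylVector b).choose_spec.1 i hi

/-- `ρ` is the half-sum of the positive roots. -/
theorem two_smul_weylVector [Finite ι] {P : RootDatum ι X Y} [P.IsReduced] [IsSimplyConnected P]
    (b : P.Base) : 2 • weylVector b = ∑ᶠ (i : ι) (_ : b.IsPos i), P.root i := by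
  classical
  have := Fintype.ofFinite ι
  have hsum : (∑ᶠ (i : ι) (_ : b.IsPos i), P.root i) =
      ∑ i ∈ Finset.univ.filter (fun i => b.IsPos i), P.root i := by
    apply finsum_mem_eq_sum_of_inter_support_eq
    refine Set.ext fun i => and_congr_left fun _ => ?_
    constructor
    · intro h
      simpa using (show b.IsPos i from h)
    · intro h
      change b.IsPos i
      simpa using h
  rw [hsum]
  apply eq_of_coroot_eq P b
  intro j hj
  set S := ∑ i ∈ Finset.univ.filter (fun i => b.IsPos i), P.root i with hS
  set T := ∑ i ∈ (Finset.univ.filter (fun i => b.IsPos i)).erase j, P.root i with hT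
  have hjp : b.IsPos j := b.isPos_of_mem_support hj
  have hST : S = T + P.root j := by
    rw [hS, hT, Finset.sum_erase_add]
    simpa using hjp
  have hrefl : P.reflection j T = T := by
    rw [hT, map_sum]
    refine Finset.sum_bij (fun i _ => P.reflectionPerm j i) ?_ ?_ ?_ ?_
    · intro i hi
      simp only [Finset.mem_erase, Finset.mem_filter, Finset.mem_univ, true_and] at hi ⊢
      refine ⟨?_, hi.2.reflectionPerm hj hi.1⟩
      intro h
      have h2 : i = P.reflectionPerm j j := by rw [← P.reflectionPerm_self j i, h]
      let := P.indexNeg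
      have h4 : b.IsPos (-j) := by
        have : -j = P.reflectionPerm j j := rfl
        rw [this, ← h2]; exact hi.2
      exact (RootPairing.Base.IsPos.neg_iff_not b j).1 h4 hjp
    · intro a _ c _ h
      exact (P.reflectionPerm j).injective h
    · intro i hi
      simp only [Finset.mem_erase, Finset.mem_filter, Finset.mem_univ, true_and] at hi
      refine ⟨P.reflectionPerm j i, ?_, by simp⟩
      simp only [Finset.mem_erase, Finset.mem_filter, Finset.mem_univ, true_and]
      refine ⟨?_, hi.2.reflectionPerm hj hi.1⟩
      intro h
      have h2 : i = P.reflectionPerm j j := by rw [← P.reflectionPerm_self j i, h]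
      let := P.indexNeg
      have h4 : b.IsPos (-j) := by
        have : -j = P.reflectionPerm j j := rfl
        rw [this, ← h2]; exact hi.2
      exact (RootPairing.Base.IsPos.neg_iff_not b j).1 h4 hjp
    · intro i _
      simp
  have hzero : P.toLinearMap T (P.coroot j) = 0 := by
    have h1 := P.reflection_apply j T
    rw [hrefl] at h1
    have h2 : (P.toLinearMap T (P.coroot j)) • P.root j = 0 := by
      have : T = T - (P.toLinearMap T (P.coroot j)) • P.root j := h1
      exact sub_eq_self.1 this.symm
    have h3 := congrArg (fun z => P.toLinearMap z (P.coroot j)) h2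
    simpa using h3
  rw [hST, map_add, LinearMap.add_apply, hzero, map_nsmul, LinearMap.smul_apply,
    weylVector_coroot b hj]
  simp

/-- The Weyl group is finite. -/
instance finite_weylGroup [Finite ι] (P : RootDatum ι X Y) [IsSimplyConnected P] :
    Finite P.weylGroup := by
  refine Finite.of_injective (fun w : P.weylGroup => P.weylGroupToPerm w) ?_
  intro v w h
  apply Subtype.ext
  apply RootPairing.Equiv.coweightHom_injective P
  apply MulOpposite.unop_injective
  apply LinearEquiv.toLinearMap_injective
  apply LinearMap.ext_on_range (v := P.coroot) IsSimplyConnected.span_coroot_eq_top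
  intro i
  have h1 := congrFun v.1.coroot_coweightMap i
  have h2 := congrFun w.1.coroot_coweightMap i
  have h3 : v.1.indexEquiv = w.1.indexEquiv := h
  rw [← h3] at h2
  exact h1.trans h2.symm

/-- The sign `(-1) ^ ℓ(w)` of an element of the Weyl group: its determinant on the weight
lattice. -/
def weylSign (P : RootDatum ι X Y) (w : P.weylGroup) : ℤ :=
  LinearMap.det (RootPairing.Equiv.weightHom P w : X →ₗ[ℤ] X)

theorem weylSign_mul (P : RootDatum ι X Y) (v w : P.weylGroup) :
    weylSign P (v * w) = weylSign P v * weylSign P w := by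
  simp only [weylSign, ← LinearMap.det_comp]
  rfl

theorem weylSign_ofIdx [Module.Free ℤ X] [Module.Finite ℤ X] (P : RootDatum ι X Y) (i : ι) :
    weylSign P (RootPairing.weylGroup.ofIdx P i) = -1 := by
  have h : (RootPairing.Equiv.weightHom P (RootPairing.weylGroup.ofIdx P i) : X →ₗ[ℤ] X) =
      LinearMap.transvection (-(P.coroot' i)) (P.root i) := by
    ext x
    change P.reflection i x = _
    rw [P.reflection_apply]
    simp [LinearMap.transvection.apply, sub_eq_add_neg]
  rw [weylSign, h, LinearMap.transvection.det]
  simp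

/-- The dot action `w • λ = w(λ + ρ) - ρ`. -/
def dotAction {P : RootDatum ι X Y} [IsSimplyConnected P] (b : P.Base) (w : P.weylGroup) (x : X) :
    X :=
  w • (x + weylVector b) - weylVector b

/-- The numerator `∑_{w ∈ W} (-1)^{ℓ(w)} e(w • λ)` of Weyl's character formula. -/
def weylNumerator {P : RootDatum ι X Y} [IsSimplyConnected P] (b : P.Base) (x : X) :
    AddMonoidAlgebra ℤ X :=
  ∑ᶠ w : P.weylGroup, weylSign P w • e (dotAction b w x)

/-- The denominator `∏_{α > 0} (1 - e(-α))` of Weyl's character formula. -/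
def weylDenominator {P : RootDatum ι X Y} (b : P.Base) : AddMonoidAlgebra ℤ X :=
  ∏ᶠ (i : ι) (_ : b.IsPos i), (1 - e (-P.root i))

theorem weylDenominator_eq_prod [Fintype ι] {P : RootDatum ι X Y} (b : P.Base)
    [DecidablePred b.IsPos] :
    weylDenominator b = ∏ i ∈ Finset.univ.filter (fun i => b.IsPos i), (1 - e (-P.root i)) := by
  apply finprod_mem_eq_prod_of_inter_mulSupport_eq
  refine Set.ext fun i => and_congr_left fun _ => ?_
  constructor
  · intro h
    simpa using (show b.IsPos i from h)
  · intro h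
    change b.IsPos i
    simpa using h

theorem nsmul_root_ne_zero (P : RootDatum ι X Y) (i : ι) (n : ℕ) (hn : 0 < n) :
    n • (-P.root i) ≠ 0 := by
  intro h
  have h1 := congrArg (fun z => P.toLinearMap z (P.coroot i)) h
  simp at h1
  omega

theorem weylDenominator_regular [Finite ι] {P : RootDatum ι X Y} (b : P.Base)
    {g : AddMonoidAlgebra ℤ X} (h : weylDenominator b * g = 0) : g = 0 := by
  classical
  have := Fintype.ofFinite ι
  rw [weylDenominator_eq_prod] at h
  revert h
  induction Finset.univ.filter (fun i => b.IsPos i) using Finset.induction_on with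
  | empty => simp
  | insert i s hi ih =>
    intro h
    rw [Finset.prod_insert hi, mul_assoc] at h
    exact ih (one_sub_e_regular (nsmul_root_ne_zero P i) h)

theorem one_sub_e_dvd_weylNumerator [Finite ι] [Module.Free ℤ X] [Module.Finite ℤ X] {P : RootDatum ι X Y}
    [IsSimplyConnected P] (b : P.Base) (x : X) (i : ι) :
    (1 - e (-P.root i)) ∣ weylNumerator b x := by
  have := Fintype.ofFinite P.weylGroup
  rw [one_sub_e_dvd_iff, weylNumerator, finsum_eq_sum_of_fintype, map_sum]
  have hz : ∀ z : AddMonoidAlgebra ℤ (X ⧸ AddSubgroup.zmultiples (-P.root i)), z = -z → z = 0 := by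
    intro z hz
    ext q
    have h1 := congrArg (fun z => z.coeff q) hz
    simp at h1
    simp; omega
  apply hz
  rw [← Finset.sum_neg_distrib]
  refine Fintype.sum_equiv (Equiv.mulLeft (RootPairing.weylGroup.ofIdx P i)) _ _ ?_
  intro w
  simp only [Equiv.coe_mulLeft, weylSign_mul, weylSign_ofIdx, map_zsmul, modRoot_e]
  have h2 : QuotientAddGroup.mk' (AddSubgroup.zmultiples (-P.root i)) (dotAction b w x) =
      QuotientAddGroup.mk' (AddSubgroup.zmultiples (-P.root i))
        (dotAction b (RootPairing.weylGroup.ofIdx P i * w) x) := by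
    rw [QuotientAddGroup.mk'_eq_mk']
    refine ⟨P.toLinearMap (w • (x + weylVector b)) (P.coroot i) • (-P.root i),
      AddSubgroup.zsmul_mem_zmultiples _ _, ?_⟩
    simp only [dotAction, mul_smul]
    have h3 : RootPairing.weylGroup.ofIdx P i • (w • (x + weylVector b)) =
      w • (x + weylVector b) -
        P.toLinearMap (w • (x + weylVector b)) (P.coroot i) • P.root i := rfl
    rw [h3, smul_neg]
    abel
  rw [h2]
  simp

theorem zsmul_root_ne_nsmul_root {P : RootDatum ι X Y} [P.IsReduced] (b : P.Base) {i j : ι}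
    (hi : b.IsPos i) (hj : b.IsPos j) (hij : i ≠ j) (n : ℕ) (hn : 0 < n) (k : ℤ) :
    k • (-P.root i) ≠ n • (-P.root j) := by
  intro h
  have hne : P.root i ≠ -P.root j := by
    intro h'
    let := P.indexNeg
    have : i = -j := P.root.injective (by simpa using h')
    rw [this] at hi
    exact (RootPairing.Base.IsPos.neg_iff_not b j).1 hi hj
  have hli := RootPairing.IsReduced.linearIndependent P hij hne
  rw [LinearIndependent.pair_iff] at hli
  have := hli k (-n) (by
    rw [neg_smul, natCast_zsmul, ← sub_eq_add_neg, sub_eq_zero]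
    simpa using h)
  omega

theorem existsUnique_weylCharacter [Finite ι] [Module.Free ℤ X] [Module.Finite ℤ X] {P : RootDatum ι X Y}
    [P.IsReduced] [IsSimplyConnected P] (b : P.Base) (x : X) :
    ∃! f : AddMonoidAlgebra ℤ X, f * weylDenominator b = weylNumerator b x := by
  classical
  have := Fintype.ofFinite ι
  have hd : weylDenominator b ∣ weylNumerator b x := by
    rw [weylDenominator_eq_prod]
    apply prod_one_sub_e_dvd
    · intro i hi j hj hij n hn k
      simp only [Finset.mem_filter, Finset.mem_univ, true_and] at hi hj
      exact zsmul_root_ne_nsmul_root b hi hj hij n hn k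
    · intro i _
      exact one_sub_e_dvd_weylNumerator b x i
  obtain ⟨f, hf⟩ := hd
  refine ⟨f, by rw [hf, mul_comm], fun g hg => ?_⟩
  have : weylDenominator b * (g - f) = 0 := by
    rw [mul_sub, ← hf, ← hg, mul_comm, sub_self]
  exact sub_eq_zero.1 (weylDenominator_regular b this)

/-- The Euler characteristic `χ(λ)` in `ℤ[X]`, given by Weyl's character formula
`χ(λ) ∏_{α > 0} (1 - e(-α)) = ∑_{w ∈ W} (-1)^{ℓ(w)} e(w • λ)`, which determines it; for dominant
`λ` it is a Weyl character. -/
def weylCharacter [Finite ι] [Module.Free ℤ X] [Module.Finite ℤ X] {P : RootDatum ι X Y} [P.IsReduced]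
    [IsSimplyConnected P] (b : P.Base) (x : X) : AddMonoidAlgebra ℤ X :=
  (existsUnique_weylCharacter b x).choose

theorem weylCharacter_mul_weylDenominator [Finite ι] [Module.Free ℤ X] [Module.Finite ℤ X] {P : RootDatum ι X Y}
    [P.IsReduced] [IsSimplyConnected P] (b : P.Base) (x : X) :
    weylCharacter b x * weylDenominator b = weylNumerator b x :=
  (existsUnique_weylCharacter b x).choose_spec.1

/-- `λ` is dominant. -/
def IsDominant {P : RootDatum ι X Y} (b : P.Base) (x : X) : Prop :=
  ∀ i ∈ b.support, 0 ≤ P.toLinearMap x (P.coroot i)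

/-- The standard partial order on weights: `x ≤ y` if `y - x` is a sum of simple roots. -/
def WeightLE {P : RootDatum ι X Y} (b : P.Base) (x y : X) : Prop :=
  y - x ∈ AddSubmonoid.closure (P.root '' b.support)

/-- The affine reflection `s_{α, m}(λ) = λ - (⟨λ, α^∨⟩ - m) α`, where `α` is the root indexed
by `i`. -/
def affineReflection (P : RootDatum ι X Y) (i : ι) (m : ℤ) (x : X) : X :=
  x - (P.toLinearMap x (P.coroot i) - m) • P.root i

/-- The dot action of an affine reflection: `s • λ = s(λ + ρ) - ρ`. -/
def dotAffineReflection {P : RootDatum ι X Y} [IsSimplyConnected P] (b : P.Base) (i : ι) (m : ℤ)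
    (x : X) : X :=
  affineReflection P i m (x + weylVector b) - weylVector b

/-- The order `x ↑ y`: there is a (possibly empty) chain
`x ≤ s₁ • x ≤ s₂ • s₁ • x ≤ ⋯ ≤ sₘ • ⋯ • s₁ • x = y`, where each `sⱼ` is an affine reflection
`s_{α, np}` with `α` a positive root and `n` an integer. No dominance is required along the
chain. -/
def UpLinked {P : RootDatum ι X Y} [IsSimplyConnected P] (b : P.Base) (p : ℕ) : X → X → Prop :=
  Relation.ReflTransGen fun x y =>
    WeightLE b x y ∧ ∃ i, b.IsPos i ∧ ∃ n : ℤ, y = dotAffineReflection b i (n * p) x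

/-- Membership in `ℤ[X]^W`. -/
def IsWeylInvariant (P : RootDatum ι X Y) (f : AddMonoidAlgebra ℤ X) : Prop :=
  ∀ w : P.weylGroup, AddMonoidAlgebra.mapDomain (fun x => w • x) f = f

/-- The orbit sum `s(μ)`: the sum of `e(ν)` over all `ν` in the Weyl group orbit of `μ`. -/
def orbitSum (P : RootDatum ι X Y) (x : X) : AddMonoidAlgebra ℤ X :=
  ∑ᶠ y ∈ MulAction.orbit P.weylGroup x, e y

/-- The coefficients of `f` in the basis of Weyl characters are nonnegative: `f` is a linear
combination, with natural number coefficients, of the `χ(ν)` for `ν` dominant. -/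
def HasNonnegWeylCoeffs [Finite ι] [Module.Free ℤ X] [Module.Finite ℤ X] {P : RootDatum ι X Y}
    [P.IsReduced] [IsSimplyConnected P] (b : P.Base) (f : AddMonoidAlgebra ℤ X) : Prop :=
  ∃ a : {x : X // IsDominant b x} →₀ ℕ, f = a.sum fun x n => n • weylCharacter b x

end WeylChar

end

/-! Since `η` is Weyl-invariant, `c μ` is the coefficient of `e(μ)` in `η`, so both parts compare
coefficients of `η` at two weights.

The source of all inequalities is a comparison along root strings, valid for every `q ≥ 1`: if the
products of `η` with the `χ((q-1)ρ + qλ)` are nonnegative, then `η(ν + kqα) ≤ η(ν)` for `k ≥ 0` and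
`⟨ν, α^∨⟩ ≥ -kq`. For `α` simple and `k ≥ 1`, choose `λ` so that `(q-1)ρ + qλ + ρ` pairs to `kq`
with `α^∨` and to something huge with the other simple coroots. By Weyl's formula the relevant
coefficient of the product is an alternating sum over `W`; the huge pairings push every term except
those of `1` and `s_α` out of the support of `η`, leaving `η(ν) - η(ν + kqα) ≥ 0`
(`coeff_add_simple_le`). Conjugating by `W` gives all roots (`coeff_add_root_le`).

Part 1 is `q = 1`: a simple root may be subtracted from a weight pairing positively with its coroot
without lowering the coefficient, and positive definiteness of the invariant form lets one descend
in this way to a dominant weight (`le_of_weightLE`).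

Part 2 is `q = p`. A reflection in `⟨·, α^∨⟩ = np` that moves a weight away from the origin is, up
to `s_α`, a string step, so it cannot raise the coefficient. An upward chain may however cross
hyperplanes with `n < 0` towards the origin. Upward steps move away from a point far out in the
antidominant direction; that point is moved to the origin along a generic ray, crossing one
hyperplane at a time, and at each crossing the lifting property `reflTransGen_lifting` rewrites the
chain with that hyperplane reversed. It applies because both ends, being dominant, lie on the same
side of the hyperplane. -/

noncomputable section

namespace WeylChar

/-! ### The Weyl group: invariant form, positive cone, exchange property, stabilizers. -/

section WeylGroup

variable {ι X Y : Type*} [AddCommGroup X] [AddCommGroup Y]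

section Form

variable [Finite ι] (P : RootDatum ι X Y)

/-- The canonical Weyl-invariant symmetric form `∑_α ⟨x, α^∨⟩ ⟨y, α^∨⟩` on the weight lattice. -/
def rootForm : LinearMap.BilinForm ℤ X :=
  letI := Fintype.ofFinite ι
  P.RootForm

theorem rootForm_apply_self_nonneg (x : X) : 0 ≤ rootForm P x x := by
  let := Fintype.ofFinite ι
  rw [rootForm, RootPairing.rootForm_apply_apply]
  exact Finset.sum_nonneg fun i _ => mul_self_nonneg _

theorem toLinearMap_eq_zero_of_rootForm {x : X} (h : rootForm P x x = 0) (i : ι) :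
    P.toLinearMap x (P.coroot i) = 0 := by
  let := Fintype.ofFinite ι
  rw [rootForm, RootPairing.rootForm_apply_apply,
    Finset.sum_eq_zero_iff_of_nonneg fun i _ => mul_self_nonneg _] at h
  exact mul_self_eq_zero.1 (h i (Finset.mem_univ i))

theorem rootForm_root_self_pos (i : ι) : 0 < rootForm P (P.root i) (P.root i) := by
  refine lt_of_le_of_ne (rootForm_apply_self_nonneg P _) fun h => ?_
  simpa using toLinearMap_eq_zero_of_rootForm P h.symm i

/-- This lets signs of pairings with a coroot be read off the invariant form, where the Weyl group
acts by isometries. -/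
theorem two_mul_rootForm_root (x : X) (i : ι) :
    2 * rootForm P x (P.root i) =
      rootForm P (P.root i) (P.root i) * P.toLinearMap x (P.coroot i) := by
  let := Fintype.ofFinite ι
  have h := congrArg (P.toLinearMap x) (P.rootForm_self_smul_coroot i)
  rw [map_smul, map_nsmul, RootPairing.toLinearMap_apply_apply_Polarization] at h
  have h1 : P.RootForm x (P.root i) = P.RootForm (P.root i) x :=
    P.rootForm_symmetric.eq x (P.root i)
  rw [rootForm, h1]
  simpa using h.symm

theorem rootForm_root_pos_iff (x : X) (i : ι) :
    0 < rootForm P x (P.root i) ↔ 0 < P.toLinearMap x (P.coroot i) := by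
  have h := two_mul_rootForm_root P x i
  have h1 := rootForm_root_self_pos P i
  rw [← mul_pos_iff_of_pos_left (b := P.toLinearMap x (P.coroot i)) h1, ← h]
  omega

theorem rootForm_root_nonneg_iff (x : X) (i : ι) :
    0 ≤ rootForm P x (P.root i) ↔ 0 ≤ P.toLinearMap x (P.coroot i) := by
  have h := two_mul_rootForm_root P x i
  have h1 := rootForm_root_self_pos P i
  rw [← mul_nonneg_iff_of_pos_left (b := P.toLinearMap x (P.coroot i)) h1, ← h]
  omega

omit [Finite ι] in
theorem ofIdx_smul_eq (i : ι) (x : X) :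
    RootPairing.weylGroup.ofIdx P i • x = x - P.toLinearMap x (P.coroot i) • P.root i :=
  rfl

theorem rootForm_smul_smul (w : P.weylGroup) (x y : X) :
    rootForm P (w • x) (w • y) = rootForm P x y := by
  let := Fintype.ofFinite ι
  revert x y
  obtain ⟨w, hw⟩ := w
  induction hw using RootPairing.weylGroup.induction with
  | mem i => exact fun x y => P.rootForm_reflection_reflection_apply i x y
  | one => exact fun x y => by simp
  | mul g₁ g₂ hg₁ hg₂ h₁ h₂ =>
    intro x y
    rw [← Submonoid.mk_mul_mk _ _ _ hg₁ hg₂, mul_smul, mul_smul, h₁, h₂]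

omit [Finite ι] in
theorem exists_root_eq_smul (w : P.weylGroup) (i : ι) : ∃ j, P.root j = w • P.root i :=
  ⟨_, (P.weylGroup_apply_root w i).symm⟩

theorem toLinearMap_smul_coroot {w : P.weylGroup} {i j : ι} (h : P.root j = w • P.root i) (x : X) :
    P.toLinearMap (w • x) (P.coroot j) = P.toLinearMap x (P.coroot i) := by
  have h1 := two_mul_rootForm_root P (w • x) j
  rw [h, rootForm_smul_smul, rootForm_smul_smul, two_mul_rootForm_root P x i] at h1
  exact (mul_left_cancel₀ (rootForm_root_self_pos P i).ne' h1).symm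

omit [Finite ι] in
theorem weylGroup_ext {v w : P.weylGroup} (h : ∀ x : X, v • x = w • x) : v = w := by
  apply Subtype.ext
  apply RootPairing.Equiv.weightHom_injective P
  exact LinearEquiv.ext h

theorem ofIdx_mul_eq_mul_ofIdx {w : P.weylGroup} {i j : ι} (h : P.root j = w • P.root i) :
    RootPairing.weylGroup.ofIdx P j * w = w * RootPairing.weylGroup.ofIdx P i := by
  apply weylGroup_ext
  intro x
  rw [mul_smul, mul_smul, ofIdx_smul_eq, ofIdx_smul_eq, toLinearMap_smul_coroot P h, smul_sub, h,
    smul_comm w]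

omit [Finite ι] in
theorem ofIdx_mul_self (i : ι) :
    RootPairing.weylGroup.ofIdx P i * RootPairing.weylGroup.ofIdx P i = 1 := by
  apply weylGroup_ext
  intro x
  rw [mul_smul, one_smul]
  exact P.reflection_same i x

end Form

section Cone

variable {P : RootDatum ι X Y} (b : P.Base)

/-- The nonnegative integral combinations of the simple roots. -/
def positiveCone : AddSubmonoid X := AddSubmonoid.closure (P.root '' b.support)

theorem root_mem_positiveCone {i : ι} (hi : i ∈ b.support) : P.root i ∈ positiveCone b :=
  AddSubmonoid.subset_closure ⟨i, hi, rfl⟩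

variable {b} in
theorem root_mem_of_isPos {i : ι} (hi : b.IsPos i) : P.root i ∈ positiveCone b := by
  obtain ⟨f, -, h | h⟩ := b.exists_root_eq_sum_nat_or_neg i
  · rw [h]
    exact sum_mem fun j hj => nsmul_mem (root_mem_positiveCone b hj) _
  · exfalso
    have h1 : P.root i = ∑ j ∈ b.support, (fun j => -(f j : ℤ)) j • P.root j := by
      simp [h]
    have h2 := RootPairing.Base.height_eq_sum h1
    have h3 : b.height i ≤ 0 := by
      rw [h2]
      exact Finset.sum_nonpos fun j _ => by simp
    exact absurd hi (not_lt.2 h3)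

variable [Finite ι]

variable {b} in
theorem rootForm_nonneg {x y : X} (hx : IsDominant b x) (hy : y ∈ positiveCone b) :
    0 ≤ rootForm P x y := by
  induction hy using AddSubmonoid.closure_induction with
  | mem _ h =>
    obtain ⟨i, hi, rfl⟩ := h
    exact (rootForm_root_nonneg_iff P x i).2 (hx i hi)
  | zero => simp
  | add y z _ _ h1 h2 =>
    rw [map_add]
    exact add_nonneg h1 h2

variable {b} in
theorem rootForm_pos {x y : X} (hx : ∀ i ∈ b.support, 0 < P.toLinearMap x (P.coroot i))
    (hy : y ∈ positiveCone b) (hy0 : y ≠ 0) : 0 < rootForm P x y := by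
  suffices h : y = 0 ∨ 0 < rootForm P x y from h.resolve_left hy0
  clear hy0
  induction hy using AddSubmonoid.closure_induction with
  | mem _ h =>
    obtain ⟨i, hi, rfl⟩ := h
    exact Or.inr ((rootForm_root_pos_iff P x i).2 (hx i hi))
  | zero => simp
  | add y z _ _ h1 h2 =>
    rw [map_add]
    rcases h1 with rfl | h1
    · simpa using h2
    · rcases h2 with rfl | h2
      · simpa using Or.inr h1
      · exact Or.inr (add_pos h1 h2)

variable [IsSimplyConnected P]

omit [Finite ι] in
theorem weylVector_pos : ∀ i ∈ b.support, 0 < P.toLinearMap (weylVector b) (P.coroot i) :=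
  fun _ hi => by simp [weylVector_coroot b hi]

variable {b} in
theorem eq_zero_of_mem_of_neg_mem {x : X} (hx : x ∈ positiveCone b) (hx' : -x ∈ positiveCone b) :
    x = 0 := by
  by_contra h
  have h1 := rootForm_pos (weylVector_pos b) hx h
  have h2 := rootForm_pos (weylVector_pos b) hx' (neg_ne_zero.2 h)
  rw [map_neg] at h2
  omega

include b in
theorem rootForm_self_pos {x : X} (hx : x ≠ 0) : 0 < rootForm P x x := by
  refine lt_of_le_of_ne (rootForm_apply_self_nonneg P _) fun h => hx ?_
  exact eq_of_coroot_eq P b fun i _ => by simp [toLinearMap_eq_zero_of_rootForm P h.symm i]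

variable {b}

theorem isPos_iff_root_mem {i : ι} : b.IsPos i ↔ P.root i ∈ positiveCone b := by
  refine ⟨root_mem_of_isPos, fun h => ?_⟩
  let := P.indexNeg
  refine (RootPairing.Base.IsPos.or_neg b i).resolve_right fun h' => ?_
  have h1 := root_mem_of_isPos h'
  rw [RootPairing.indexNeg_neg, RootPairing.root_reflectionPerm,
    RootPairing.reflection_apply_self] at h1
  exact P.ne_zero i (eq_zero_of_mem_of_neg_mem h h1)

omit [Finite ι] [IsSimplyConnected P] in
theorem root_mem_or_neg_mem_of_smul (w : P.weylGroup) (i : ι) :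
    w • P.root i ∈ positiveCone b ∨ -(w • P.root i) ∈ positiveCone b := by
  obtain ⟨j, hj⟩ := exists_root_eq_smul P w i
  rw [← hj]
  exact b.root_mem_or_neg_mem j

omit [Finite ι] [IsSimplyConnected P] in
theorem smul_root_ne_zero (w : P.weylGroup) (i : ι) : w • P.root i ≠ 0 := by
  obtain ⟨j, hj⟩ := exists_root_eq_smul P w i
  rw [← hj]
  exact P.ne_zero j

omit [IsSimplyConnected P] in
theorem ofIdx_smul_root_mem [P.IsReduced] {i j : ι} (hi : b.IsPos i) (hj : j ∈ b.support)
    (hij : i ≠ j) : RootPairing.weylGroup.ofIdx P j • P.root i ∈ positiveCone b := by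
  have h := root_mem_of_isPos (hi.reflectionPerm hj hij)
  rw [RootPairing.root_reflectionPerm] at h
  exact h

omit [Finite ι] [IsSimplyConnected P] in
theorem ofIdx_smul_root_self (i : ι) :
    RootPairing.weylGroup.ofIdx P i • P.root i = -P.root i :=
  P.reflection_apply_self i

/-! ### Words in the simple reflections -/

variable (P) in
/-- The product of the reflections with the given indices. -/
def reflectionWord (L : List ι) : P.weylGroup := (L.map (RootPairing.weylGroup.ofIdx P)).prod

omit [Finite ι] [IsSimplyConnected P] in
theorem reflectionWord_cons (i : ι) (L : List ι) :
    reflectionWord P (i :: L) = RootPairing.weylGroup.ofIdx P i * reflectionWord P L := by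
  simp [reflectionWord]

/-- Apply the letters to the simple root from the right. At the letter `k` where the root turns
negative it must equal the simple root `k`, because a simple reflection permutes the other positive
roots. That letter can then be moved through the rest of the word to the far right, where it becomes
`i`. -/
theorem exchange [P.IsReduced] {i : ι} (hi : i ∈ b.support) (L : List ι)
    (hL : ∀ j ∈ L, j ∈ b.support) (h : -(reflectionWord P L • P.root i) ∈ positiveCone b) :
    ∃ L' : List ι, (∀ j ∈ L', j ∈ b.support) ∧ L'.length < L.length ∧
      reflectionWord P L = reflectionWord P L' * RootPairing.weylGroup.ofIdx P i := by
  induction L with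
  | nil =>
    simp only [reflectionWord, List.map_nil, List.prod_nil, one_smul] at h
    exact absurd (eq_zero_of_mem_of_neg_mem (root_mem_positiveCone b hi) h) (P.ne_zero i)
  | cons j L ih =>
    have hj : j ∈ b.support := hL j (by simp)
    have hL' : ∀ k ∈ L, k ∈ b.support := fun k hk => hL k (by simp [hk])
    rcases root_mem_or_neg_mem_of_smul (b := b) (reflectionWord P L) i with hv | hv
    · obtain ⟨k, hk⟩ := exists_root_eq_smul P (reflectionWord P L) i
      rw [← hk] at hv
      have hkj : k = j := by
        by_contra hkj
        have h1 := ofIdx_smul_root_mem (isPos_iff_root_mem.2 hv) hj hkj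
        rw [reflectionWord_cons, mul_smul, ← hk] at h
        exact smul_root_ne_zero _ _ (eq_zero_of_mem_of_neg_mem h1 h)
      subst hkj
      exact ⟨L, hL', by simp, by rw [reflectionWord_cons, ofIdx_mul_eq_mul_ofIdx P hk]⟩
    · obtain ⟨L', h1, h2, h3⟩ := ih hL' hv
      refine ⟨j :: L', ?_, by simpa using h2, ?_⟩
      · intro k hk
        rcases List.mem_cons.1 hk with rfl | hk
        · exact hj
        · exact h1 k hk
      · rw [reflectionWord_cons, reflectionWord_cons, h3, mul_assoc]

omit [IsSimplyConnected P] in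
theorem ofIdx_reflectionPerm (i j : ι) :
    RootPairing.weylGroup.ofIdx P (P.reflectionPerm j i) =
      RootPairing.weylGroup.ofIdx P j * RootPairing.weylGroup.ofIdx P i *
        RootPairing.weylGroup.ofIdx P j := by
  have h : P.root (P.reflectionPerm j i) = RootPairing.weylGroup.ofIdx P j • P.root i := by
    rw [RootPairing.root_reflectionPerm]
    rfl
  rw [← ofIdx_mul_eq_mul_ofIdx P h, mul_assoc, ofIdx_mul_self, mul_one]

omit [IsSimplyConnected P] in
variable (b) in
theorem exists_reflectionWord [P.IsReduced] (w : P.weylGroup) :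
    ∃ L : List ι, (∀ j ∈ L, j ∈ b.support) ∧ w = reflectionWord P L := by
  let S : Subgroup P.weylGroup :=
    Subgroup.closure (RootPairing.weylGroup.ofIdx P '' b.support)
  have hS : ∀ i, RootPairing.weylGroup.ofIdx P i ∈ S := by
    intro i
    refine b.induction_reflect (p := fun i => RootPairing.weylGroup.ofIdx P i ∈ S) i ?_
      (fun i hi => Subgroup.subset_closure ⟨i, hi, rfl⟩) ?_
    · intro i hi
      rw [ofIdx_reflectionPerm]
      exact mul_mem (mul_mem hi hi) hi
    · intro i j hi hj
      have hj' : RootPairing.weylGroup.ofIdx P j ∈ S := Subgroup.subset_closure ⟨j, hj, rfl⟩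
      rw [ofIdx_reflectionPerm]
      exact mul_mem (mul_mem hj' hi) hj'
  have hw : w ∈ S := by
    obtain ⟨w, hw⟩ := w
    induction hw using RootPairing.weylGroup.induction with
    | mem i => exact hS i
    | one => exact one_mem S
    | mul g₁ g₂ hg₁ hg₂ h₁ h₂ => exact mul_mem h₁ h₂
  induction hw using Subgroup.closure_induction_left with
  | one => exact ⟨[], by simp, by simp [reflectionWord]⟩
  | mul_left x hx y _ h =>
    obtain ⟨i, hi, rfl⟩ := hx
    obtain ⟨L, hL, rfl⟩ := h
    refine ⟨i :: L, ?_, (reflectionWord_cons i L).symm⟩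
    intro k hk
    rcases List.mem_cons.1 hk with rfl | hk
    · exact hi
    · exact hL k hk
  | inv_mul_cancel x hx y _ h =>
    obtain ⟨i, hi, rfl⟩ := hx
    obtain ⟨L, hL, rfl⟩ := h
    refine ⟨i :: L, ?_, ?_⟩
    · intro k hk
      rcases List.mem_cons.1 hk with rfl | hk
      · exact hi
      · exact hL k hk
    · rw [reflectionWord_cons, inv_eq_of_mul_eq_one_left (ofIdx_mul_self P i)]

variable (b) in
/-- Every element of the Weyl group has a minimal word: dropping the last letter `i` leaves an
element that sends the simple root `i` to a positive root. -/
theorem weylGroup_induction [P.IsReduced] {p : P.weylGroup → Prop} (one : p 1)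
    (mul : ∀ w i, i ∈ b.support → w • P.root i ∈ positiveCone b → p w →
      p (w * RootPairing.weylGroup.ofIdx P i)) (w : P.weylGroup) : p w := by
  obtain ⟨L, hL, rfl⟩ := exists_reflectionWord b w
  generalize hn : L.length = n
  induction n using Nat.strong_induction_on generalizing L with
  | _ n ih =>
    subst hn
    rcases List.eq_nil_or_concat' L with rfl | ⟨L, i, rfl⟩
    · simpa [reflectionWord] using one
    · have hw : reflectionWord P (L ++ [i]) =
          reflectionWord P L * RootPairing.weylGroup.ofIdx P i := by
        simp [reflectionWord]
      have hi : i ∈ b.support := hL i (by simp)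
      have hL' : ∀ j ∈ L, j ∈ b.support := fun j hj => hL j (by simp [hj])
      rcases root_mem_or_neg_mem_of_smul (b := b) (reflectionWord P L) i with hv | hv
      · rw [hw]
        exact mul _ i hi hv (ih L.length (by simp) L hL' rfl)
      · obtain ⟨L', h1, h2, h3⟩ := exchange hi L hL' hv
        rw [hw, h3, mul_assoc, ofIdx_mul_self, mul_one]
        exact ih L'.length (by simp; omega) L' h1 rfl

/-- A nontrivial element has a minimal word, and it makes the simple root of the last letter
negative. -/
theorem eq_one_of_smul_simple_mem [P.IsReduced] {w : P.weylGroup}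
    (h : ∀ i ∈ b.support, w • P.root i ∈ positiveCone b) : w = 1 := by
  have key : w = 1 ∨ ∃ i ∈ b.support, -(w • P.root i) ∈ positiveCone b := by
    clear h
    induction w using weylGroup_induction b with
    | one => exact Or.inl rfl
    | mul w i hi hw _ =>
      refine Or.inr ⟨i, hi, ?_⟩
      rwa [mul_smul, ofIdx_smul_root_self, smul_neg, neg_neg]
  refine key.resolve_right ?_
  rintro ⟨i, hi, h'⟩
  exact smul_root_ne_zero w i (eq_zero_of_mem_of_neg_mem (h i hi) h')

/-- Peel off the last letter `i` of a minimal word: dominance of both weights forces `x` to be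
orthogonal to the simple root `i`, so that letter fixes `x`. -/
theorem smul_eq_self_of_isDominant [P.IsReduced] {w : P.weylGroup} {x : X}
    (hx : IsDominant b x) (hwx : IsDominant b (w • x)) : w • x = x := by
  induction w using weylGroup_induction b with
  | one => exact one_smul _ x
  | mul w i hi hw ih =>
    set s := RootPairing.weylGroup.ofIdx P i
    have h1 : 0 ≤ rootForm P ((w * s) • x) (w • P.root i) := rootForm_nonneg hwx hw
    have h2 : rootForm P ((w * s) • x) (w • P.root i) = -rootForm P x (P.root i) := by
      rw [mul_smul, rootForm_smul_smul, ← rootForm_smul_smul P s, ← mul_smul, ofIdx_mul_self,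
        one_smul, ofIdx_smul_root_self, map_neg]
    have h3 := (rootForm_root_nonneg_iff P x i).2 (hx i hi)
    have h4 : 2 * rootForm P x (P.root i) = 0 := by omega
    rw [two_mul_rootForm_root] at h4
    have h5 := (mul_eq_zero.1 h4).resolve_left (rootForm_root_self_pos P i).ne'
    have h6 : s • x = x := by
      rw [ofIdx_smul_eq, h5]
      simp
    rw [mul_smul, h6] at hwx ⊢
    exact ih hwx

theorem eq_one_of_smul_eq_self [P.IsReduced] {w : P.weylGroup} {x : X}
    (hx : ∀ i ∈ b.support, 0 < P.toLinearMap x (P.coroot i)) (h : w • x = x) : w = 1 := by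
  refine eq_one_of_smul_simple_mem (b := b) fun i hi => ?_
  refine (root_mem_or_neg_mem_of_smul w i).resolve_right fun h' => ?_
  have h1 := rootForm_nonneg (fun i hi => (hx i hi).le) h'
  have h2 := rootForm_smul_smul P w x (P.root i)
  have h3 := (rootForm_root_pos_iff P x i).2 (hx i hi)
  rw [h] at h2
  rw [map_neg, h2] at h1
  omega

/-- An element of the stabilizer cannot make a simple root negative unless that root is orthogonal
to `x`, which leaves only `a`; multiplying by the reflection in `a` corrects this sign. -/
theorem eq_one_or_eq_ofIdx_of_smul_eq_self [P.IsReduced] {w : P.weylGroup} {x : X} {a : ι}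
    (hx0 : P.toLinearMap x (P.coroot a) = 0)
    (hx : ∀ i ∈ b.support, i ≠ a → 0 < P.toLinearMap x (P.coroot i)) (h : w • x = x) :
    w = 1 ∨ w = RootPairing.weylGroup.ofIdx P a := by
  have hd : IsDominant b x := fun i hi => by
    by_cases hia : i = a
    · rw [hia, hx0]
    · exact (hx i hi hia).le
  have key : ∀ v : P.weylGroup, v • x = x → v • P.root a ∈ positiveCone b → v = 1 := by
    intro v hv hva
    refine eq_one_of_smul_simple_mem (b := b) fun i hi => ?_
    by_cases hia : i = a
    · rwa [hia]
    refine (root_mem_or_neg_mem_of_smul v i).resolve_right fun h' => ?_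
    have h1 := rootForm_nonneg hd h'
    have h2 := rootForm_smul_smul P v x (P.root i)
    have h3 := (rootForm_root_pos_iff P x i).2 (hx i hi hia)
    rw [hv] at h2
    rw [map_neg, h2] at h1
    omega
  rcases root_mem_or_neg_mem_of_smul (b := b) w a with hw | hw
  · exact Or.inl (key w h hw)
  · right
    have h1 := key (w * RootPairing.weylGroup.ofIdx P a) ?_ ?_
    · rw [mul_eq_one_iff_eq_inv] at h1
      rw [h1, inv_eq_of_mul_eq_one_left (ofIdx_mul_self P a)]
    · rw [mul_smul, ofIdx_smul_eq, hx0, zero_smul, sub_zero, h]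
    · rwa [mul_smul, ofIdx_smul_root_self, smul_neg]

omit [IsSimplyConnected P] in
variable (b) in
theorem exists_smul_simple_eq_root [P.IsReduced] (i : ι) :
    ∃ w : P.weylGroup, ∃ j ∈ b.support, P.root i = w • P.root j := by
  refine b.induction_reflect (p := fun i => ∃ w : P.weylGroup, ∃ j ∈ b.support,
    P.root i = w • P.root j) i ?_ (fun i hi => ⟨1, i, hi, (one_smul _ _).symm⟩) ?_
  · rintro i ⟨w, j, hj, h⟩
    refine ⟨RootPairing.weylGroup.ofIdx P i * w, j, hj, ?_⟩
    rw [mul_smul, ← h, RootPairing.root_reflectionPerm]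
    rfl
  · rintro i k ⟨w, j, hj, h⟩ _
    refine ⟨RootPairing.weylGroup.ofIdx P k * w, j, hj, ?_⟩
    rw [mul_smul, ← h, RootPairing.root_reflectionPerm]
    rfl

end Cone

end WeylGroup

/-! ### Comparison of the coefficients of `η` along root strings. -/

section StringComparison

variable {ι X Y : Type*} [AddCommGroup X] [AddCommGroup Y]

theorem coeff_e_mul (a x : X) (f : AddMonoidAlgebra ℤ X) : (e a * f).coeff x = f.coeff (x - a) := by
  rw [e, AddMonoidAlgebra.coeff_single_mul_apply, one_mul, neg_add_eq_sub]

omit [AddCommGroup X] in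
theorem coeff_e_self (x : X) : (e x).coeff x = 1 := by
  simp [e]

omit [AddCommGroup X] in
theorem coeff_e_of_ne {x y : X} (h : x ≠ y) : (e x).coeff y = 0 := by
  simp [e, h]

theorem coeff_smul_of_isWeylInvariant {P : RootDatum ι X Y} {η : AddMonoidAlgebra ℤ X}
    (hη : IsWeylInvariant P η) (w : P.weylGroup) (x : X) : η.coeff (w • x) = η.coeff x := by
  conv_lhs => rw [← hη w]
  rw [AddMonoidAlgebra.coeff_mapDomain]
  exact Finsupp.mapDomain_apply (MulAction.injective w) _ _

theorem weylSign_one (P : RootDatum ι X Y) : weylSign P 1 = 1 := by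
  simp [weylSign]

section

variable {P : RootDatum ι X Y} [IsSimplyConnected P]

/-- The simple coroots as a basis of the cocharacter lattice. -/
def simpleCorootBasis (b : P.Base) : Module.Basis b.support ℤ Y :=
  Module.Basis.mk (v := fun i : b.support => P.coroot i) b.linearIndepOn_coroot <| by
    have h : Set.range (fun i : b.support => P.coroot i) = P.coroot '' b.support := by
      ext; simp
    rw [h, b.span_int_coroot_support, IsSimplyConnected.span_coroot_eq_top]

theorem simpleCorootBasis_apply (b : P.Base) (i : b.support) :
    simpleCorootBasis b i = P.coroot i := by
  exact Module.Basis.mk_apply _ _ i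

variable (P) in
/-- Weights with prescribed pairings with the simple coroots exist. -/
theorem exists_weight (b : P.Base) (f : ι → ℤ) :
    ∃ x : X, ∀ i ∈ b.support, P.toLinearMap x (P.coroot i) = f i := by
  let g : Y →ₗ[ℤ] ℤ := (simpleCorootBasis b).constr ℤ (fun i => f i)
  refine ⟨P.toLinearMap.toPerfPair.symm g, fun i hi => ?_⟩
  have h1 : g (simpleCorootBasis b ⟨i, hi⟩) = f i := (simpleCorootBasis b).constr_basis ℤ _ _
  rw [← h1, simpleCorootBasis_apply, ← LinearMap.toPerfPair_apply, LinearEquiv.apply_symm_apply]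

variable {b : P.Base}

theorem add_weylVector_pos {x : X} (hx : IsDominant b x) :
    ∀ i ∈ b.support, 0 < P.toLinearMap (x + weylVector b) (P.coroot i) := by
  intro i hi
  have h := hx i hi
  rw [map_add, LinearMap.add_apply, weylVector_coroot b hi]
  omega

variable [Finite ι] [P.IsReduced]

theorem eq_one_of_dotAction_eq {x y : X} (hx : IsDominant b x) (hy : IsDominant b y)
    {w : P.weylGroup} (h : dotAction b w x = y) : w = 1 := by
  have h1 : w • (x + weylVector b) = y + weylVector b := by
    rw [← h, dotAction, sub_add_cancel]
  have hx' := add_weylVector_pos hx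
  refine eq_one_of_smul_eq_self hx'
    (smul_eq_self_of_isDominant (b := b) (fun i hi => (hx' i hi).le) ?_)
  rw [h1]
  exact fun i hi => (add_weylVector_pos hy i hi).le

/-- A dot orbit meets the dominant weights at most once, and then only through `w = 1`, whose sign
is positive. -/
theorem coeff_weylNumerator_nonneg {x y : X} (hx : IsDominant b x) (hy : IsDominant b y) :
    0 ≤ (weylNumerator b x).coeff y := by
  have := Fintype.ofFinite P.weylGroup
  rw [weylNumerator, finsum_eq_sum_of_fintype, AddMonoidAlgebra.coeff_sum, Finsupp.finsetSum_apply]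
  refine Finset.sum_nonneg fun w _ => ?_
  by_cases h : dotAction b w x = y
  · rw [eq_one_of_dotAction_eq hx hy h, weylSign_one]
    rw [eq_one_of_dotAction_eq hx hy h] at h
    rw [h, one_smul, coeff_e_self]
    exact zero_le_one
  · rw [AddMonoidAlgebra.coeff_smul_apply, coeff_e_of_ne h, smul_zero]

omit [Finite ι] [P.IsReduced] in
theorem coeff_weylNumerator_mul [Fintype P.weylGroup] (x y : X) (η : AddMonoidAlgebra ℤ X) :
    (weylNumerator b x * η).coeff y =
      ∑ w : P.weylGroup, weylSign P w * η.coeff (y - dotAction b w x) := by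
  rw [weylNumerator, finsum_eq_sum_of_fintype, Finset.sum_mul, AddMonoidAlgebra.coeff_sum,
    Finsupp.finsetSum_apply]
  refine Finset.sum_congr rfl fun w _ => ?_
  rw [smul_mul_assoc, AddMonoidAlgebra.coeff_smul_apply, coeff_e_mul, smul_eq_mul]

variable [Module.Free ℤ X] [Module.Finite ℤ X]

/-- The coefficient of `e(y)` in the product with the numerator is the coefficient of `χ(y)` in the
product with the Weyl character. -/
theorem coeff_weylNumerator_mul_nonneg {x y : X} {η : AddMonoidAlgebra ℤ X}
    (h : HasNonnegWeylCoeffs b (weylCharacter b x * η)) (hy : IsDominant b y) :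
    0 ≤ (weylNumerator b x * η).coeff y := by
  obtain ⟨a, ha⟩ := h
  have h1 : weylNumerator b x * η = a.sum fun z n => n • weylNumerator b (z : X) := by
    rw [← weylCharacter_mul_weylDenominator, mul_right_comm, ha, Finsupp.sum, Finset.sum_mul]
    refine Finset.sum_congr rfl fun z _ => ?_
    rw [smul_mul_assoc, weylCharacter_mul_weylDenominator]
  rw [h1, Finsupp.sum, AddMonoidAlgebra.coeff_sum, Finsupp.finsetSum_apply]
  refine Finset.sum_nonneg fun z _ => ?_
  rw [AddMonoidAlgebra.coeff_smul_apply]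
  exact nsmul_nonneg (coeff_weylNumerator_nonneg z.2 hy) _

open Filter in
/-- Multiplying by `χ(λ)` with `λ + ρ` very regular away from one simple root compares the
coefficients of `η` along the strings of this simple root. -/
theorem coeff_add_simple_le {q : ℕ} (hq : 0 < q) {η : AddMonoidAlgebra ℤ X}
    (hη : IsWeylInvariant P η)
    (H : ∀ x : X, IsDominant b x →
      HasNonnegWeylCoeffs b
        (weylCharacter b (((q : ℤ) - 1) • weylVector b + (q : ℤ) • x) * η))
    {a : ι} (ha : a ∈ b.support) {k : ℤ} (hk : 1 ≤ k) {ν : X}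
    (hν : -(k * q) ≤ P.toLinearMap ν (P.coroot a)) :
    η.coeff (ν + (k * q) • P.root a) ≤ η.coeff ν := by
  classical
  have := Fintype.ofFinite P.weylGroup
  set s := RootPairing.weylGroup.ofIdx P a with hs
  -- In the boundary case the two weights are exchanged by `s`. It is separate because the weight at
  -- which the coefficient is taken below would pair to `-1` with the coroot of `a`.
  rcases hν.eq_or_lt with hν | hν
  · rw [← coeff_smul_of_isWeylInvariant hη s ν, hs, ofIdx_smul_eq, ← hν, neg_smul, sub_neg_eq_add]
  -- The value `k - 1` makes `lam N + ρ` pair to exactly `kq` with the coroot of `a`; the direction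
  -- `σ` is fixed by `1` and `s` only.
  obtain ⟨x₀, hx₀⟩ := exists_weight P b (fun i => if i = a then k - 1 else 0)
  obtain ⟨σ, hσ⟩ := exists_weight P b (fun i => if i = a then 0 else 1)
  let x : ℕ → X := fun N => x₀ + N • σ
  let lam : ℕ → X := fun N => ((q : ℤ) - 1) • weylVector b + (q : ℤ) • x N
  have hx : ∀ N, ∀ i ∈ b.support,
      P.toLinearMap (x N) (P.coroot i) = if i = a then k - 1 else (N : ℤ) := by
    intro N i hi
    simp only [x, map_add, map_nsmul, LinearMap.add_apply, LinearMap.smul_apply, hx₀ i hi, hσ i hi]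
    split_ifs <;> simp
  have hlam : ∀ N, lam N + weylVector b = (q : ℤ) • (weylVector b + x₀) + N • ((q : ℤ) • σ) := by
    intro N
    simp only [lam, x]
    module
  have hdom : ∀ N, IsDominant b (x N) := by
    intro N i hi
    rw [hx N i hi]
    split_ifs <;> omega
  have hstab : ∀ w : P.weylGroup, w ≠ 1 → w ≠ s → (q : ℤ) • σ - w • ((q : ℤ) • σ) ≠ 0 := by
    intro w h1 h2 h
    rw [smul_comm, ← smul_sub] at h
    have h3 : (q : ℤ) ≠ 0 := by omega
    have h4 : w • σ = σ := by
      refine (sub_eq_zero.1 ?_).symm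
      apply eq_of_coroot_eq P b
      intro i hi
      have h5 := congrArg (fun z => P.toLinearMap z (P.coroot i)) h
      rw [map_zsmul, LinearMap.smul_apply, smul_eq_mul, map_zero, LinearMap.zero_apply] at h5
      rw [(mul_eq_zero.1 h5).resolve_left h3]
      simp
    rcases eq_one_or_eq_ofIdx_of_smul_eq_self (b := b) (a := a) (by simp [hσ a ha])
      (fun i hi hia => by simp [hσ i hi, hia]) h4 with h5 | h5
    · exact h1 h5
    · exact h2 h5
  have hev1 : ∀ w : P.weylGroup, w ≠ 1 → w ≠ s → ∀ᶠ N in atTop,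
      η.coeff (lam N + ν - dotAction b w (lam N)) = 0 := by
    intro w h1 h2
    -- As `N` varies these weights run along a line with nonzero direction, so only finitely many
    -- `N` hit the support of `η`.
    have hinj : Function.Injective fun N : ℕ => lam N + ν - dotAction b w (lam N) := by
      intro M N h
      have h3 : ∀ N, lam N + ν - dotAction b w (lam N) = ν + ((q : ℤ) • (weylVector b + x₀) -
          w • ((q : ℤ) • (weylVector b + x₀))) + N • ((q : ℤ) • σ - w • ((q : ℤ) • σ)) := by
        intro N
        have h4 : lam N = (lam N + weylVector b) - weylVector b := by abel
        rw [dotAction, hlam, h4, hlam, smul_add w, smul_comm w N, smul_sub N]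
        abel
      simp only [h3] at h
      have h4 := add_left_cancel h
      rw [← natCast_zsmul, ← natCast_zsmul] at h4
      exact Nat.cast_injective (R := ℤ) (smul_left_injective ℤ (hstab w h1 h2) h4)
    have h3 := hinj.tendsto_cofinite.eventually
      (η.coeff.support.finite_toSet.compl_mem_cofinite)
    rw [Nat.cofinite_eq_atTop] at h3
    filter_upwards [h3] with N hN
    simpa using hN
  have hev2 : ∀ᶠ N in atTop, IsDominant b (lam N + ν) := by
    have h1 : ∀ i ∈ b.support, ∀ᶠ N in atTop,
        0 ≤ P.toLinearMap (lam N + ν) (P.coroot i) := by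
      intro i hi
      filter_upwards [eventually_ge_atTop (P.toLinearMap ν (P.coroot i)).natAbs] with N hN
      simp only [lam, map_add, map_zsmul, LinearMap.add_apply, LinearMap.smul_apply, hx N i hi,
        weylVector_coroot b hi, smul_eq_mul]
      split_ifs with hia
      · subst hia
        linarith
      · have h2 : (N : ℤ) ≤ q * N := by
          have : (1 : ℤ) ≤ q := by omega
          nlinarith
        omega
    exact (eventually_all_finset _).2 h1
  have hev3 : ∀ᶠ N in atTop, ∀ w : P.weylGroup, w ≠ 1 → w ≠ s →
      η.coeff (lam N + ν - dotAction b w (lam N)) = 0 := by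
    refine eventually_all.2 fun w => ?_
    by_cases h1 : w = 1
    · simp [h1]
    by_cases h2 : w = s
    · simp [h2]
    filter_upwards [hev1 w h1 h2] with N hN _ _
    exact hN
  obtain ⟨N, hN2, hN3⟩ := (hev2.and hev3).exists
  have hmain := coeff_weylNumerator_mul_nonneg (H (x N) (hdom N)) hN2
  have hsign : weylSign P s = -1 := weylSign_ofIdx P a
  have hs1 : (1 : P.weylGroup) ≠ s := by
    intro h
    rw [← h, weylSign_one] at hsign
    omega
  change 0 ≤ (weylNumerator b (lam N) * η).coeff (lam N + ν) at hmain
  -- Only `1` and `s` survive, with opposite signs.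
  rw [coeff_weylNumerator_mul, ← Finset.sum_subset (Finset.subset_univ {1, s}),
    Finset.sum_pair hs1, hsign, weylSign_one] at hmain
  · have e1 : lam N + ν - dotAction b 1 (lam N) = ν := by
      rw [dotAction, one_smul]
      abel
    have e2 : lam N + ν - dotAction b s (lam N) = ν + (k * q) • P.root a := by
      have h1 : P.toLinearMap (lam N + weylVector b) (P.coroot a) = k * q := by
        simp only [lam, map_add, map_zsmul, LinearMap.add_apply, LinearMap.smul_apply, hx N a ha,
          weylVector_coroot b ha, smul_eq_mul, if_true]
        ring
      rw [dotAction, hs, ofIdx_smul_eq, h1]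
      abel
    rw [e1, e2] at hmain
    linarith
  · intro w _ hw
    simp only [Finset.mem_insert, Finset.mem_singleton, not_or] at hw
    rw [hN3 w hw.1 hw.2, mul_zero]

/-- The comparison along the strings of an arbitrary root. -/
theorem coeff_add_root_le {q : ℕ} (hq : 0 < q) {η : AddMonoidAlgebra ℤ X}
    (hη : IsWeylInvariant P η)
    (H : ∀ x : X, IsDominant b x →
      HasNonnegWeylCoeffs b
        (weylCharacter b (((q : ℤ) - 1) • weylVector b + (q : ℤ) • x) * η))
    {i : ι} {k : ℤ} (hk : 0 ≤ k) {ν : X}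
    (hν : -(k * q) ≤ P.toLinearMap ν (P.coroot i)) :
    η.coeff (ν + (k * q) • P.root i) ≤ η.coeff ν := by
  rcases hk.eq_or_lt with rfl | hk
  · simp
  obtain ⟨w, a, ha, hw⟩ := exists_smul_simple_eq_root b i
  have h1 : w • (w⁻¹ • ν) = ν := smul_inv_smul w ν
  rw [← h1, toLinearMap_smul_coroot P hw] at hν
  have h2 := coeff_add_simple_le hq hη H ha hk hν
  rw [← coeff_smul_of_isWeylInvariant hη w, smul_add, h1, smul_comm w, ← hw,
    ← coeff_smul_of_isWeylInvariant hη w (w⁻¹ • ν), h1] at h2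
  exact h2

end

end StringComparison

/-! ### Orbit sums and descent in the dominance order. -/

section DominanceOrder

variable {ι X Y : Type*} [AddCommGroup X] [AddCommGroup Y]

variable [Finite ι] {P : RootDatum ι X Y} [P.IsReduced] [IsSimplyConnected P] {b : P.Base}

theorem coeff_orbitSum {x y : X} (hx : IsDominant b x) (hy : IsDominant b y) [Decidable (x = y)] :
    (orbitSum P x).coeff y = if x = y then 1 else 0 := by
  classical
  have hfin : (MulAction.orbit P.weylGroup x).Finite := Set.finite_range _
  rw [orbitSum, finsum_mem_eq_finite_toFinset_sum _ hfin, AddMonoidAlgebra.coeff_sum,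
    Finsupp.finsetSum_apply]
  split_ifs with hxy
  · subst hxy
    rw [Finset.sum_eq_single_of_mem x (by simp), coeff_e_self]
    intro z _ hz
    exact coeff_e_of_ne hz
  · refine Finset.sum_eq_zero fun z hz => coeff_e_of_ne ?_
    rintro rfl
    obtain ⟨w, rfl⟩ := hfin.mem_toFinset.1 hz
    exact hxy (smul_eq_self_of_isDominant hx hy).symm

theorem coeff_sum_orbitSum (c : {x : X // IsDominant b x} →₀ ℤ) (y : {x : X // IsDominant b x}) :
    (c.sum fun x z => z • orbitSum P (x : X)).coeff y = c y := by
  classical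
  rw [Finsupp.sum, AddMonoidAlgebra.coeff_sum, Finsupp.finsetSum_apply]
  simp only [AddMonoidAlgebra.coeff_smul_apply, coeff_orbitSum (Subtype.prop _) y.prop,
    Subtype.coe_inj]
  by_cases hy : y ∈ c.support
  · rw [Finset.sum_eq_single_of_mem y hy]
    · simp
    · intro z _ hz
      simp [hz]
  · rw [Finset.sum_eq_zero]
    · simpa using (Finsupp.notMem_support_iff.1 hy).symm
    · intro z hz
      have : z ≠ y := by
        rintro rfl
        exact hy hz
      simp [this]

omit [P.IsReduced] in
/-- A nonzero sum of simple roots pairs positively with the coroot of one of them. -/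
theorem exists_mem_pairing_pos {l : List X} (hl : ∀ x ∈ l, x ∈ P.root '' b.support)
    (h0 : l.sum ≠ 0) :
    ∃ i ∈ b.support, P.root i ∈ l ∧ 0 < P.toLinearMap l.sum (P.coroot i) := by
  by_contra! h
  -- If no root in the list paired positively with the sum, expanding the form of the sum with
  -- itself over the list would give a value `≤ 0`.
  have key : ∀ m : List X, (∀ x ∈ m, x ∈ l) → rootForm P l.sum m.sum ≤ 0 := by
    intro m
    induction m with
    | nil => simp
    | cons x m ih =>
      intro hm
      obtain ⟨i, hi, rfl⟩ := hl x (hm x (by simp))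
      have h1 := h i hi (hm _ (by simp))
      rw [← not_lt, ← rootForm_root_pos_iff, not_lt] at h1
      rw [List.sum_cons, map_add]
      exact add_nonpos h1 (ih fun x hx => hm x (by simp [hx]))
  exact absurd (rootForm_self_pos b h0) (not_lt.2 (key l fun _ => id))

omit [P.IsReduced] in
/-- A function on the weights that does not decrease when a simple root is subtracted from a weight
pairing positively with its coroot is larger at dominant weights than at the weights above. -/
theorem le_of_weightLE {m : X → ℤ}
    (hm : ∀ x, ∀ i ∈ b.support, 0 < P.toLinearMap x (P.coroot i) → m x ≤ m (x - P.root i))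
    {x y : X} (hx : IsDominant b x) (hxy : WeightLE b x y) : m y ≤ m x := by
  classical
  obtain ⟨l, hl, hsum⟩ := AddSubmonoid.exists_list_of_mem_closure hxy
  rw [eq_sub_iff_add_eq'] at hsum
  subst hsum
  clear hxy
  induction hn : l.length generalizing l with
  | zero => simp [List.length_eq_zero_iff.1 hn]
  | succ n ih =>
    by_cases h0 : l.sum = 0
    · simp [h0]
    obtain ⟨i, hi, hil, hpos⟩ := exists_mem_pairing_pos hl h0
    have h1 : x + l.sum - P.root i = x + (l.erase (P.root i)).sum := by
      rw [← List.sum_erase hil]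
      abel
    -- Only the lower weight `x` has to be dominant; the intermediate weights need not be.
    refine (hm _ i hi ?_).trans ?_
    · rw [map_add, LinearMap.add_apply]
      exact add_pos_of_nonneg_of_pos (hx i hi) hpos
    · rw [h1]
      refine ih _ (fun x hx => hl x (List.mem_of_mem_erase hx)) ?_
      rw [List.length_erase_of_mem hil]
      omega

end DominanceOrder

/-! ### The lifting property and affine reflections. -/

section AffineReflections

section Lifting

/-- The lifting property: let `s` be an involution preserving the relation `R`, and let `D` hold for
at least one of `x` and `s x`. Passing from the steps `x → s x` with `D x` to the reversed steps
preserves the order between points whose images under `s` satisfy `D`. -/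
theorem reflTransGen_lifting {α : Type*} {R : α → α → Prop} {s : α → α} {D : α → Prop}
    (hs : ∀ x, s (s x) = x) (hR : ∀ x y, R x y → R (s x) (s y)) (hD : ∀ x, D x ∨ D (s x))
    {x y : α} (hx : D (s x)) (hy : D (s y))
    (h : Relation.ReflTransGen (fun u v => R u v ∨ D u ∧ v = s u) x y) :
    Relation.ReflTransGen (fun u v => R u v ∨ D (s u) ∧ v = s u) x y := by
  set B : α → α → Prop := fun u v => R u v ∨ D u ∧ v = s u
  have step : ∀ u, D u → B u (s u) := fun u hu => Or.inr ⟨hu, rfl⟩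
  -- Fold along `s`: a chain from `u` to `v` yields a chain between any representatives of `{u, s
  -- u}` and `{v, s v}` satisfying `D`. When a representative is carried to the wrong one of the two
  -- points, the step `y' → s y'` is inserted before the `R` step.
  have hB : ∀ u v, Relation.ReflTransGen B u v → ∀ u', (u' = u ∨ u' = s u) → D u' →
      ∀ v', (v' = v ∨ v' = s v) → D v' → Relation.ReflTransGen B u' v' := by
    have same : ∀ u, ∀ u', (u' = u ∨ u' = s u) → D u' →
        ∀ v', (v' = u ∨ v' = s u) → D v' → Relation.ReflTransGen B u' v' := by
      rintro u u' (rfl | rfl) hu' v' (rfl | rfl) hv'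
      · exact .refl
      · exact .single (step _ hu')
      · convert Relation.ReflTransGen.single (step _ hu')
        exact (hs _).symm
      · exact .refl
    intro u v huv
    induction huv with
    | refl => exact same u
    | @tail y z _ hyz ih =>
      intro u' hu hu' v' hv hv'
      obtain ⟨y', hy, hy'⟩ : ∃ y', (y' = y ∨ y' = s y) ∧ D y' := by
        rcases hD y with h | h
        · exact ⟨y, Or.inl rfl, h⟩
        · exact ⟨s y, Or.inr rfl, h⟩
      refine (ih u' hu hu' y' hy hy').trans ?_
      rcases hyz with hyz | ⟨_, rfl⟩
      · rcases hy with rfl | rfl <;> rcases hv with rfl | rfl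
        · exact .single (Or.inl hyz)
        · exact .head (step _ hy') (.single (Or.inl (hR _ _ hyz)))
        · refine .head (step _ hy') (.single (Or.inl ?_))
          rwa [hs]
        · exact .single (Or.inl (hR _ _ hyz))
      · refine same y y' hy hy' v' ?_ hv'
        rw [hs] at hv
        exact hv.symm
  have h1 := hB x y h (s x) (Or.inr rfl) hx (s y) (Or.inr rfl) hy
  -- Applying `s` to the folded chain from `s x` to `s y` restores the ends and reverses the `s`
  -- steps.
  have h2 : Relation.ReflTransGen (fun u v => R u v ∨ D (s u) ∧ v = s u) (s (s x)) (s (s y)) :=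
    Relation.ReflTransGen.lift s ?_ _ _ h1
  · rwa [hs, hs] at h2
  · rintro u v (huv | ⟨hu, rfl⟩)
    · exact Or.inl (hR u v huv)
    · refine Or.inr ⟨?_, rfl⟩
      rwa [hs]

end Lifting

variable {ι X Y : Type*} [AddCommGroup X] [AddCommGroup Y]

section Reflections

variable (P : RootDatum ι X Y)

theorem toLinearMap_affineReflection_self (i : ι) (m : ℤ) (x : X) :
    P.toLinearMap (affineReflection P i m x) (P.coroot i) =
      2 * m - P.toLinearMap x (P.coroot i) := by
  simp [affineReflection]
  ring

theorem affineReflection_affineReflection (i : ι) (m : ℤ) (x : X) :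
    affineReflection P i m (affineReflection P i m x) = x := by
  conv_lhs => rw [affineReflection, toLinearMap_affineReflection_self, affineReflection]
  module

theorem root_reflectionPerm_same (i : ι) : P.root (P.reflectionPerm i i) = -P.root i := by
  simp

theorem coroot_reflectionPerm_same (i : ι) : P.coroot (P.reflectionPerm i i) = -P.coroot i := by
  simp

theorem affineReflection_neg (i : ι) (m : ℤ) (x : X) :
    affineReflection P (P.reflectionPerm i i) (-m) x = affineReflection P i m x := by
  simp only [affineReflection, root_reflectionPerm_same, coroot_reflectionPerm_same, map_neg]
  module

theorem toLinearMap_affineReflection_reflectionPerm (a i : ι) (m : ℤ) (x : X) :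
    P.toLinearMap (affineReflection P a m x) (P.coroot (P.reflectionPerm a i)) =
      P.toLinearMap x (P.coroot i) - m * P.toLinearMap (P.root a) (P.coroot i) := by
  rw [RootPairing.coroot_reflectionPerm, RootPairing.coreflection_apply, affineReflection]
  simp
  ring

theorem affineReflection_conj (a i : ι) (m n : ℤ) (x : X) :
    affineReflection P a m (affineReflection P i n x) =
      affineReflection P (P.reflectionPerm a i) (n - m * P.toLinearMap (P.root a) (P.coroot i))
        (affineReflection P a m x) := by
  rw [affineReflection.eq_1 P (P.reflectionPerm a i), toLinearMap_affineReflection_reflectionPerm,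
    RootPairing.root_reflectionPerm, RootPairing.reflection_apply]
  simp only [affineReflection, map_sub, map_zsmul, LinearMap.sub_apply, LinearMap.smul_apply,
    smul_eq_mul, RootPairing.coroot', LinearMap.flip_apply]
  module

/-- A reflection in an affine hyperplane that moves a point away from the side containing the real
coweight functional `z`. -/
def AwayStep (p : ℕ) (z : Y →ₗ[ℤ] ℝ) (x y : X) : Prop :=
  ∃ (i : ι) (n : ℤ), z (P.coroot i) < (n * p : ℤ) ∧ P.toLinearMap x (P.coroot i) ≤ n * p ∧
    y = affineReflection P i (n * p) x

-- The hypothesis `hz` puts `z` on the hyperplane of the reflection, which therefore fixes `z` and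
-- permutes the steps leading away from it.
variable {P} in
theorem AwayStep.affineReflection {p : ℕ} {z : Y →ₗ[ℤ] ℝ} {a : ι} {m : ℤ}
    (hz : z (P.coroot a) = (m * p : ℤ)) {x y : X} (h : AwayStep P p z x y) :
    AwayStep P p z (affineReflection P a (m * p) x) (affineReflection P a (m * p) y) := by
  obtain ⟨i, n, h1, h2, rfl⟩ := h
  have e : n * p - m * p * P.toLinearMap (P.root a) (P.coroot i) =
      (n - m * P.toLinearMap (P.root a) (P.coroot i)) * p := by ring
  refine ⟨P.reflectionPerm a i, n - m * P.toLinearMap (P.root a) (P.coroot i), ?_, ?_, ?_⟩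
  · rw [RootPairing.coroot_reflectionPerm, RootPairing.coreflection_apply, map_sub, map_zsmul, hz,
      ← e]
    push_cast at h1 ⊢
    simp only [RootPairing.root', zsmul_eq_mul]
    linarith
  · rw [toLinearMap_affineReflection_reflectionPerm, ← e]
    omega
  · rw [affineReflection_conj, e]

end Reflections

end AffineReflections

/-! ### Rewriting linkage chains as chains leading away from the origin. -/

section Linkage

variable {ι X Y : Type*} [AddCommGroup X] [AddCommGroup Y]

/-- The reals have infinite dimension over `ℚ`, and replacing basis vectors by their absolute values
only changes signs. -/
theorem exists_linearIndependent_pos_real (κ : Type*) [Finite κ] :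
    ∃ v : κ → ℝ, LinearIndependent ℤ v ∧ ∀ i, 0 < v i := by
  let B := Module.Basis.ofVectorSpace ℚ ℝ
  have hinf : Infinite (Module.Basis.ofVectorSpaceIndex ℚ ℝ) := by
    rw [← Cardinal.aleph0_le_mk_iff, B.mk_eq_rank'', Real.rank_rat_real]
    exact Cardinal.aleph0_le_continuum
  have : Nonempty (κ ↪ Module.Basis.ofVectorSpaceIndex ℚ ℝ) := by
    have := Fintype.ofFinite κ
    obtain ⟨f⟩ := Infinite.natEmbedding (Module.Basis.ofVectorSpaceIndex ℚ ℝ)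
    exact ⟨((Fintype.equivFin κ).toEmbedding.trans Fin.valEmbedding).trans ⟨f, ‹_›⟩⟩
  obtain ⟨f⟩ := this
  have hli : LinearIndependent ℚ fun i => B (f i) := B.linearIndependent.comp f f.injective
  have hne : ∀ i, B (f i) ≠ 0 := fun i => hli.ne_zero i
  have habs : ∀ i, |B (f i)| = ((if 0 < B (f i) then 1 else -1 : ℚˣ) : ℚ) • B (f i) := by
    intro i
    split_ifs with h
    · simp [abs_of_pos h]
    · simp [abs_of_nonpos (not_lt.1 h)]
  refine ⟨fun i => |B (f i)|, ?_, fun i => abs_pos.2 (hne i)⟩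
  have h1 := hli.units_smul fun i => if 0 < B (f i) then 1 else -1
  have h2 : LinearIndependent ℚ fun i => |B (f i)| := by
    convert h1 using 1
    ext i
    exact habs i
  exact h2.restrict_scalars' ℤ

section Functional

variable {P : RootDatum ι X Y} [IsSimplyConnected P] (b : P.Base)

theorem exists_regular_functional : ∃ δ : Y →ₗ[ℤ] ℝ, Function.Injective δ ∧
    ∀ i ∈ b.support, 0 < δ (P.coroot i) := by
  obtain ⟨v, hv, hpos⟩ := exists_linearIndependent_pos_real b.support
  refine ⟨(simpleCorootBasis b).constr ℤ v, ?_, fun i hi => ?_⟩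
  · rw [injective_iff_map_eq_zero]
    intro y hy
    rw [Module.Basis.constr_apply_fintype] at hy
    apply (simpleCorootBasis b).repr.injective
    ext i
    simpa using Fintype.linearIndependent_iff.1 hv _ hy i
  · rw [← simpleCorootBasis_apply b ⟨i, hi⟩, Module.Basis.constr_basis]
    exact hpos _

variable {b} [Finite ι]

/-- Positivity of `i` is defined through roots. It passes to coroots because `ρ` pairs positively
with the coroot of a positive root, hence that coroot cannot be a negative combination. -/
theorem coroot_mem_of_isPos {i : ι} (hi : b.IsPos i) :
    P.coroot i ∈ AddSubmonoid.closure (P.coroot '' b.support) := by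
  refine (b.coroot_mem_or_neg_mem i).resolve_right fun h => ?_
  have h1 : 0 < P.toLinearMap (weylVector b) (P.coroot i) :=
    (rootForm_root_pos_iff P _ i).1
      (rootForm_pos (weylVector_pos b) (root_mem_of_isPos hi) (P.ne_zero i))
  have key : ∀ y ∈ AddSubmonoid.closure (P.coroot '' b.support),
      0 ≤ P.toLinearMap (weylVector b) y := by
    intro y hy
    induction hy using AddSubmonoid.closure_induction with
    | mem _ h =>
      obtain ⟨j, hj, rfl⟩ := h
      exact (weylVector_pos b j hj).le
    | zero => simp
    | add y z _ _ h1 h2 =>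
      rw [map_add]
      exact add_nonneg h1 h2
  have h2 := key _ h
  rw [map_neg] at h2
  omega

theorem functional_coroot_pos {δ : Y →ₗ[ℤ] ℝ} (hδ : ∀ i ∈ b.support, 0 < δ (P.coroot i))
    {i : ι} (hi : b.IsPos i) : 0 < δ (P.coroot i) := by
  suffices h : P.coroot i = 0 ∨ 0 < δ (P.coroot i) from
    h.resolve_left fun h0 => by simpa [h0] using P.root_coroot_two i
  have hy := coroot_mem_of_isPos hi
  generalize P.coroot i = y at hy
  clear hi
  induction hy using AddSubmonoid.closure_induction with
  | mem _ h =>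
    obtain ⟨i, hi, rfl⟩ := h
    exact Or.inr (hδ i hi)
  | zero => simp
  | add y z _ _ h1 h2 =>
    rw [map_add]
    rcases h1 with rfl | h1
    · simpa using h2
    · rcases h2 with rfl | h2
      · simpa using Or.inr h1
      · exact Or.inr (add_pos h1 h2)

/-- The time at which a point moving along `-tδ` towards the origin crosses the hyperplane
`⟨·, α_i^∨⟩ = n`. -/
def crossingTime (P : RootDatum ι X Y) (δ : Y →ₗ[ℤ] ℝ) (h : ι × ℤ) : ℝ :=
  -(h.2 : ℝ) / δ (P.coroot h.1)

/-- Equal times make the two coroots proportional, as `δ` is injective; reducedness then identifies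
the roots. So the moving point never crosses two of these hyperplanes at once. -/
theorem crossingTime_injOn [Module.Free ℤ X] [P.IsReduced] {δ : Y →ₗ[ℤ] ℝ}
    (hinj : Function.Injective δ)
    (hδ : ∀ i ∈ b.support, 0 < δ (P.coroot i)) :
    Set.InjOn (crossingTime P δ) {h | b.IsPos h.1 ∧ h.2 < 0} := by
  rintro ⟨i, m⟩ ⟨hi, hm⟩ ⟨j, n⟩ ⟨hj, hn⟩ h
  simp only [crossingTime] at h hi hm hj hn
  have hi' := functional_coroot_pos hδ hi
  have hj' := functional_coroot_pos hδ hj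
  rw [div_eq_div_iff hi'.ne' hj'.ne'] at h
  have h1 : m • P.coroot j = n • P.coroot i := by
    apply hinj
    rw [map_zsmul, map_zsmul, zsmul_eq_mul, zsmul_eq_mul]
    linarith
  have hij : i = j := by
    by_contra hij
    have : Module.Free ℤ Y := Module.Free.of_basis (simpleCorootBasis b)
    have hne : P.flip.root j ≠ -P.flip.root i := by
      intro h2
      have h3 : δ (P.coroot j) = -δ (P.coroot i) := by
        rw [← map_neg]
        exact congrArg δ h2
      linarith
    have h4 := RootPairing.IsReduced.linearIndependent P.flip (Ne.symm hij) hne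
    rw [LinearIndependent.pair_iff] at h4
    have h5 := h4 m (-n) (by rw [neg_smul, ← sub_eq_add_neg, sub_eq_zero]; exact h1)
    omega
  subst hij
  rw [mul_right_cancel_iff_of_pos hi', neg_inj, Int.cast_inj] at h
  rw [h]

theorem finite_crossingTime_le {δ : Y →ₗ[ℤ] ℝ} (hδ : ∀ i ∈ b.support, 0 < δ (P.coroot i))
    (T : ℝ) : {h : ι × ℤ | b.IsPos h.1 ∧ h.2 < 0 ∧ crossingTime P δ h ≤ T}.Finite := by
  refine (Set.finite_iUnion fun i : ι =>
    (Set.finite_Icc (-⌈T * δ (P.coroot i)⌉) 0).image fun n => (i, n)).subset ?_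
  rintro ⟨i, n⟩ ⟨hi, hn, hT⟩
  simp only [crossingTime] at hi hn hT
  rw [div_le_iff₀ (functional_coroot_pos hδ hi)] at hT
  refine Set.mem_iUnion.2 ⟨i, n, ⟨?_, hn.le⟩, rfl⟩
  have h1 := hT.trans (Int.le_ceil _)
  have h2 : -n ≤ ⌈T * δ (P.coroot i)⌉ := by exact_mod_cast h1
  omega

end Functional

section Linkage

variable {P : RootDatum ι X Y} (b : P.Base) (p : ℕ)

/-- A reflection in a hyperplane `⟨·, α^∨⟩ = np` with `α` positive, oriented in the direction of `α`
if `0 ≤ n` or the hyperplane belongs to `E`, and in the opposite direction otherwise. -/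
def OrientedStep (E : Finset (ι × ℤ)) (x y : X) : Prop :=
  ∃ (i : ι) (n : ℤ), b.IsPos i ∧ y = affineReflection P i (n * p) x ∧
    ((0 ≤ n ∨ (i, n) ∈ E) ∧ P.toLinearMap x (P.coroot i) ≤ n * p ∨
      n < 0 ∧ (i, n) ∉ E ∧ n * p ≤ P.toLinearMap x (P.coroot i))

variable {b} [Finite ι] [IsSimplyConnected P] [P.IsReduced]

/-- `E` is the set of hyperplanes with `n < 0` that the moving point has yet to cross; the induction
crosses them in order of decreasing time. -/
theorem reflTransGen_orientedStep_empty [Module.Free ℤ X] {p : ℕ} (hp : 0 < p) {δ : Y →ₗ[ℤ] ℝ}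
    (hinj : Function.Injective δ) (hδ : ∀ i ∈ b.support, 0 < δ (P.coroot i))
    {x y : X} (hx : IsDominant b x) (hy : IsDominant b y) (E : Finset (ι × ℤ))
    (hE : ∀ h ∈ E, b.IsPos h.1 ∧ h.2 < 0)
    (hlow : ∀ h ∈ E, ∀ h' : ι × ℤ, b.IsPos h'.1 → h'.2 < 0 →
      crossingTime P δ h' ≤ crossingTime P δ h → h' ∈ E)
    (h : Relation.ReflTransGen (OrientedStep b p E) x y) :
    Relation.ReflTransGen (OrientedStep b p ∅) x y := by
  classical
  have hp' : (0 : ℝ) < p := by exact_mod_cast hp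
  induction hn : E.card generalizing E with
  | zero => rwa [Finset.card_eq_zero.1 hn] at h
  | succ k ih =>
    have hne : E.Nonempty := Finset.card_pos.1 (by omega)
    obtain ⟨⟨a, n₀⟩, hmem, hmax⟩ := E.exists_max_image (crossingTime P δ) hne
    obtain ⟨ha, hn₀⟩ := hE _ hmem
    simp only at ha hn₀
    set t := crossingTime P δ (a, n₀) with ht
    have hδa := functional_coroot_pos hδ ha
    have hta : t * δ (P.coroot a) = -n₀ := by
      rw [ht, crossingTime, div_mul_cancel₀ _ hδa.ne']
    have ht0 : 0 < t := by
      have : (n₀ : ℝ) < 0 := by exact_mod_cast hn₀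
      by_contra h'
      have := mul_nonpos_of_nonpos_of_nonneg (not_lt.1 h') hδa.le
      linarith
    have hlt_max : ∀ h ∈ E, h ≠ (a, n₀) → crossingTime P δ h < t := by
      intro h hh hne
      refine lt_of_le_of_ne (hmax h hh) fun he => hne ?_
      exact crossingTime_injOn hinj hδ (hE h hh) (hE _ hmem) he
    -- The moving point at the moment of crossing: among hyperplanes with `n < 0` it lies on that of
    -- `(a, n₀)` only.
    let z : Y →ₗ[ℤ] ℝ := (-(t * p)) • δ
    have hz : ∀ i, z (P.coroot i) = -(t * p) * δ (P.coroot i) := fun i => rfl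
    have hza : z (P.coroot a) = (n₀ * p : ℤ) := by
      rw [hz]
      push_cast
      linear_combination (-(p : ℝ)) * hta
    have hneg : ∀ i, b.IsPos i → z (P.coroot i) < 0 := by
      intro i hi
      have := functional_coroot_pos hδ hi
      rw [hz]
      have := mul_pos (mul_pos ht0 hp') this
      linarith
    have hzlt : ∀ i n, b.IsPos i → (z (P.coroot i) < (n * p : ℤ) ↔ crossingTime P δ (i, n) < t) := by
      intro i n hi
      rw [hz, crossingTime, div_lt_iff₀ (functional_coroot_pos hδ hi)]
      push_cast
      rw [show -(t * p) * δ (P.coroot i) = -(t * δ (P.coroot i)) * p by ring,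
        mul_lt_mul_iff_left₀ hp']
      constructor <;> intro h' <;> linarith
    have hzgt : ∀ i n, b.IsPos i → ((n * p : ℤ) < z (P.coroot i) ↔ t < crossingTime P δ (i, n)) := by
      intro i n hi
      rw [hz, crossingTime, lt_div_iff₀ (functional_coroot_pos hδ hi)]
      push_cast
      rw [show -(t * p) * δ (P.coroot i) = -(t * δ (P.coroot i)) * p by ring,
        mul_lt_mul_iff_left₀ hp']
      constructor <;> intro h' <;> linarith
    let s : X → X := affineReflection P a (n₀ * p)
    let D : X → Prop := fun u => P.toLinearMap u (P.coroot a) ≤ n₀ * p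
    have hDs : ∀ u, D (s u) ↔ n₀ * p ≤ P.toLinearMap u (P.coroot a) := by
      intro u
      simp only [D, s, toLinearMap_affineReflection_self]
      constructor <;> intro h' <;> omega
    have hpos_a : ∀ u, IsDominant b u → D (s u) := by
      intro u hu
      rw [hDs]
      have h1 := (rootForm_root_nonneg_iff P u a).1 (rootForm_nonneg hu (root_mem_of_isPos ha))
      refine le_trans ?_ h1
      exact mul_nonpos_of_nonpos_of_nonneg hn₀.le (by positivity)
    -- Apart from the hyperplane being crossed, the orientation given by `E` is exactly "away from
    -- `z`". Steps in the negative direction are written with the opposite root and `-n`, which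
    -- define the same reflection.
    have hbefore : ∀ u v, OrientedStep b p E u v → AwayStep P p z u v ∨ D u ∧ v = s u := by
      rintro u v ⟨i, n, hi, rfl, ⟨h1, h2⟩ | ⟨h1, h2, h3⟩⟩
      · by_cases he : (i, n) = (a, n₀)
        · obtain ⟨rfl, rfl⟩ := Prod.ext_iff.1 he
          exact Or.inr ⟨h2, rfl⟩
        · refine Or.inl ⟨i, n, ?_, h2, rfl⟩
          rcases h1 with h1 | h1
          · refine (hneg i hi).trans_le ?_
            exact_mod_cast mul_nonneg h1 (by positivity)
          · exact (hzlt i n hi).2 (hlt_max _ h1 he)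
      · left
        have h4 : t < crossingTime P δ (i, n) := by
          by_contra h4
          exact h2 (hlow _ hmem (i, n) hi h1 (not_lt.1 h4))
        refine ⟨P.reflectionPerm i i, -n, ?_, ?_, ?_⟩
        · rw [coroot_reflectionPerm_same, map_neg]
          have := (hzgt i n hi).2 h4
          push_cast at this ⊢
          linarith
        · rw [coroot_reflectionPerm_same, map_neg]
          linarith
        · rw [neg_mul, affineReflection_neg]
    have hafter : ∀ u v, AwayStep P p z u v ∨ D (s u) ∧ v = s u →
        OrientedStep b p (E.erase (a, n₀)) u v := by
      rintro u v (⟨i, n, h1, h2, rfl⟩ | ⟨h1, rfl⟩)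
      · by_cases hi : b.IsPos i
        · refine ⟨i, n, hi, rfl, Or.inl ⟨?_, h2⟩⟩
          by_cases hn0 : 0 ≤ n
          · exact Or.inl hn0
          · right
            have h3 := (hzlt i n hi).1 h1
            refine Finset.mem_erase.2 ⟨?_, hlow _ hmem (i, n) hi (not_le.1 hn0) h3.le⟩
            intro he
            rw [he] at h3
            exact lt_irrefl _ h3
        · have hi' : b.IsPos (P.reflectionPerm i i) := (RootPairing.Base.IsPos.neg_iff_not b i).2 hi
          have h3 : (((-n) * p : ℤ) : ℝ) < z (P.coroot (P.reflectionPerm i i)) := by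
            rw [coroot_reflectionPerm_same, map_neg]
            push_cast at h1 ⊢
            linarith
          have h4 := (hzgt _ (-n) hi').1 h3
          refine ⟨P.reflectionPerm i i, -n, hi', ?_, Or.inr ⟨?_, ?_, ?_⟩⟩
          · rw [neg_mul, affineReflection_neg]
          · have h5 := h3.trans (hneg _ hi')
            have h6 : -n * (p : ℤ) < 0 := by exact_mod_cast h5
            have h7 : (0 : ℤ) < p := by exact_mod_cast hp
            by_contra h8
            exact absurd h6 (not_lt.2 (mul_nonneg (not_lt.1 h8) h7.le))
          · intro h5
            exact absurd (hmax _ (Finset.mem_of_mem_erase h5)) (not_le.2 h4)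
          · rw [coroot_reflectionPerm_same, map_neg]
            linarith
      · exact ⟨a, n₀, ha, rfl, Or.inr ⟨hn₀, Finset.notMem_erase _ _, (hDs u).1 h1⟩⟩
    have hlift := reflTransGen_lifting (R := AwayStep P p z) (s := s) (D := D)
      (affineReflection_affineReflection P a _) (fun u v huv => huv.affineReflection hza)
      (fun u => by
        rw [hDs]
        exact le_total _ _)
      (hpos_a x hx) (hpos_a y hy) (Relation.ReflTransGen.mono hbefore _ _ h)
    refine ih (E.erase (a, n₀)) (fun h hh => hE h (Finset.mem_of_mem_erase hh)) ?_
      (Relation.ReflTransGen.mono hafter _ _ hlift) (by rw [Finset.card_erase_of_mem hmem]; omega)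
    intro h hh h' h1 h2 h3
    refine Finset.mem_erase.2 ⟨?_, hlow h (Finset.mem_of_mem_erase hh) h' h1 h2 h3⟩
    rintro rfl
    exact absurd h3 (not_le.2 (hlt_max h (Finset.mem_of_mem_erase hh) (Finset.ne_of_mem_erase hh)))

omit [P.IsReduced] in
-- Otherwise the reflection would subtract a positive multiple of a positive root, so a nonzero
-- vector and its negative would both lie in the cone.
theorem le_of_weightLE_affineReflection {i : ι} (hi : b.IsPos i) {m : ℤ} {x : X}
    (h : WeightLE b x (affineReflection P i m x)) : P.toLinearMap x (P.coroot i) ≤ m := by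
  by_contra hlt
  push Not at hlt
  have h1 : affineReflection P i m x - x =
      -((P.toLinearMap x (P.coroot i) - m) • P.root i) := by
    rw [affineReflection]
    abel
  rw [WeightLE, h1] at h
  have h2 : (P.toLinearMap x (P.coroot i) - m) • P.root i ∈ positiveCone b := by
    obtain ⟨k, hk⟩ := Int.eq_ofNat_of_zero_le (sub_nonneg.2 hlt.le)
    rw [hk, natCast_zsmul]
    exact nsmul_mem (root_mem_of_isPos hi) k
  have h3 := eq_zero_of_mem_of_neg_mem h2 h
  have h4 := congrArg (fun z => P.toLinearMap z (P.coroot i)) h3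
  simp at h4
  omega

/-- Between dominant weights, a chain for the linkage order can be replaced by a chain of
reflections each of which moves a weight away from the origin. -/
theorem UpLinked.reflTransGen_orientedStep [Module.Free ℤ X] {p : ℕ} (hp : 0 < p) {x y : X}
    (hx : IsDominant b x) (hy : IsDominant b y) (h : UpLinked b p (x - weylVector b) (y - weylVector b)) :
    Relation.ReflTransGen (OrientedStep b p ∅) x y := by
  obtain ⟨δ, hinj, hδ⟩ := exists_regular_functional b
  have hfin := finite_crossingTime_le hδ
  have key : ∀ u v, UpLinked b p u v → ∃ T₀ : ℝ, ∀ T, T₀ ≤ T →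
      Relation.ReflTransGen (OrientedStep b p (hfin T).toFinset)
        (u + weylVector b) (v + weylVector b) := by
    intro u v huv
    induction huv with
    | refl => exact ⟨0, fun _ _ => .refl⟩
    | @tail v w _ hvw ih =>
      obtain ⟨T₀, hT₀⟩ := ih
      obtain ⟨hle, i, hi, n, rfl⟩ := hvw
      -- The chain is finite, so a large enough `T` puts all its hyperplanes with `n < 0` into `E`.
      refine ⟨max T₀ (crossingTime P δ (i, n)), fun T hT => ?_⟩
      refine (hT₀ T ((le_max_left _ _).trans hT)).tail ⟨i, n, hi, ?_, Or.inl ⟨?_, ?_⟩⟩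
      · rw [dotAffineReflection, sub_add_cancel]
      · by_cases hn : 0 ≤ n
        · exact Or.inl hn
        · exact Or.inr ((hfin T).mem_toFinset.2 ⟨hi, not_le.1 hn, (le_max_right _ _).trans hT⟩)
      · refine le_of_weightLE_affineReflection hi ?_
        rw [WeightLE, dotAffineReflection] at hle
        rw [WeightLE]
        convert hle using 1
        abel
  obtain ⟨T, hT⟩ := key _ _ h
  have h1 := hT T le_rfl
  rw [sub_add_cancel, sub_add_cancel] at h1
  refine reflTransGen_orientedStep_empty hp hinj hδ hx hy _ ?_ ?_ h1
  · intro h hh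
    have := (hfin T).mem_toFinset.1 hh
    exact ⟨this.1, this.2.1⟩
  · intro h hh h' h2 h3 h4
    exact (hfin T).mem_toFinset.2 ⟨h2, h3, h4.trans ((hfin T).mem_toFinset.1 hh).2.2⟩

end Linkage

end Linkage

/-! ### The two inequalities. -/

section Comparison

variable {ι X Y : Type*} [AddCommGroup X] [AddCommGroup Y] [Finite ι] [Module.Free ℤ X]
  [Module.Finite ℤ X] {P : RootDatum ι X Y} [P.IsReduced] [IsSimplyConnected P] {b : P.Base}

/-- The linear reflection in the root `α` takes `y` to `x - nqα`, so invariance turns the step into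
a string comparison: along `-α` for `n ≥ 0`, along `α` for `n < 0`. -/
theorem coeff_le_of_orientedStep {q : ℕ} (hq : 0 < q) {η : AddMonoidAlgebra ℤ X}
    (hη : IsWeylInvariant P η)
    (H : ∀ x : X, IsDominant b x →
      HasNonnegWeylCoeffs b
        (weylCharacter b (((q : ℤ) - 1) • weylVector b + (q : ℤ) • x) * η))
    {x y : X} (h : OrientedStep b q ∅ x y) : η.coeff y ≤ η.coeff x := by
  obtain ⟨i, n, -, rfl, h⟩ := h
  have h1 : RootPairing.weylGroup.ofIdx P i • affineReflection P i (n * q) x =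
      x - (n * q) • P.root i := by
    rw [ofIdx_smul_eq, toLinearMap_affineReflection_self, affineReflection]
    module
  rw [← coeff_smul_of_isWeylInvariant hη (RootPairing.weylGroup.ofIdx P i), h1]
  rcases h with ⟨h2, h3⟩ | ⟨h2, -, h3⟩
  · have h4 := coeff_add_root_le hq hη H (i := P.reflectionPerm i i) (k := n) (ν := x)
      (by simpa using h2) (by rw [coroot_reflectionPerm_same, map_neg]; omega)
    rwa [root_reflectionPerm_same, smul_neg, ← sub_eq_add_neg] at h4
  · have h4 := coeff_add_root_le hq hη H (i := i) (k := -n) (ν := x) (by omega)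
      (by rwa [neg_mul, neg_neg])
    rwa [neg_mul, neg_smul, ← sub_eq_add_neg] at h4

theorem coeff_le_of_weightLE {η : AddMonoidAlgebra ℤ X} (hη : IsWeylInvariant P η)
    (H : ∀ x : X, IsDominant b x → HasNonnegWeylCoeffs b (weylCharacter b x * η))
    {x y : X} (hx : IsDominant b x) (h : WeightLE b x y) : η.coeff y ≤ η.coeff x := by
  refine le_of_weightLE (m := fun x => η.coeff x) (fun x i _ hi => ?_) hx h
  -- With `q = 1` the weight `(q-1)ρ + qλ` is `λ`; starting the string at `x - α` requires `⟨x, α^∨⟩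
  -- - 2 ≥ -1`, which is positivity of the pairing.
  have h1 := coeff_add_root_le (q := 1) one_pos hη (by simpa using H) (i := i) (k := 1)
    (ν := x - P.root i) zero_le_one (by simp; omega)
  simpa using h1

theorem coeff_le_of_upLinked {p : ℕ} (hp : 0 < p) {η : AddMonoidAlgebra ℤ X}
    (hη : IsWeylInvariant P η)
    (H : ∀ x : X, IsDominant b x →
      HasNonnegWeylCoeffs b
        (weylCharacter b (((p : ℤ) - 1) • weylVector b + (p : ℤ) • x) * η))
    {x y : X} (hx : IsDominant b x) (hy : IsDominant b y)
    (h : UpLinked b p (x - weylVector b) (y - weylVector b)) : η.coeff y ≤ η.coeff x := by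
  have h1 := h.reflTransGen_orientedStep hp hx hy
  clear hx hy h
  induction h1 with
  | refl => exact le_rfl
  | tail _ h ih => exact (coeff_le_of_orientedStep hp hη H h).trans ih

end Comparison

end WeylChar

end

theorem theorem3p3 {ι X Y : Type*} [Finite ι] [AddCommGroup X] [AddCommGroup Y]
    [Module.Free ℤ X] [Module.Finite ℤ X]
    (P : RootDatum ι X Y) [P.IsReduced] [WeylChar.IsSimplyConnected P] (b : P.Base)
    (p : ℕ) (hp : p.Prime)
    (η : AddMonoidAlgebra ℤ X) (hη : WeylChar.IsWeylInvariant P η)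
    (c : {μ : X // WeylChar.IsDominant b μ} →₀ ℤ)
    (hc : η = c.sum fun μ z => z • WeylChar.orbitSum P (μ : X)) :
    ((∀ x : X, WeylChar.IsDominant b x →
        WeylChar.HasNonnegWeylCoeffs b (WeylChar.weylCharacter b x * η)) →
      ∀ μ μ' : {μ : X // WeylChar.IsDominant b μ},
        WeylChar.WeightLE b (μ : X) (μ' : X) → c μ' ≤ c μ) ∧
    ((∀ x : X, WeylChar.IsDominant b x →
        WeylChar.HasNonnegWeylCoeffs b
          (WeylChar.weylCharacter b (((p : ℤ) - 1) • WeylChar.weylVector b + (p : ℤ) • x) * η)) →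
      ∀ μ μ' : {μ : X // WeylChar.IsDominant b μ},
        WeylChar.UpLinked b p ((μ : X) - WeylChar.weylVector b) ((μ' : X) - WeylChar.weylVector b) →
          c μ' ≤ c μ) := by
  have hcoeff : ∀ μ : {μ : X // WeylChar.IsDominant b μ}, c μ = η.coeff (μ : X) := fun μ => by
    rw [hc, WeylChar.coeff_sum_orbitSum]
  refine ⟨fun H μ μ' h => ?_, fun H μ μ' h => ?_⟩
  · rw [hcoeff, hcoeff]
    exact WeylChar.coeff_le_of_weightLE hη H μ.2 h
  · rw [hcoeff, hcoeff]
    exact WeylChar.coeff_le_of_upLinked hp.pos hη H μ.2 μ'.2 h
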